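/- Let $A\in\mathbb{R}^{m\times n}$, let $\ell\ge 1$, and let $A_{g(1)},\dots,A_{g(\ell)}$ be linearly independent rows of $A$. Write $|s_i\rangle = A_{g(i)}/\|A_{g(i)}\|$, let $|t_1\rangle,\dots,|t_\ell\rangle$ be the orthonormal vectors obtained from $|s_1\rangle,\dots,|s_\ell\rangle$ by the Gram–Schmidt process, and let $C_\ell=(\langle s_i|s_j\rangle)_{i,j=1}^{\ell}$ and $C_{\ell-1}=(\langle s_i|s_j\rangle)_{i,j=1}^{\ell-1}$ be the Gram matrices, $|C_\ell|$, $|C_{\ell-1}|$ their determinants ($|C_0|=1$), and $\sigma_{\min}(C_\ell)$ the least singular value of $C_\ell$. Let $U_A$ be a unitary on a row register and a column register that maps $|i\rangle|0\rangle\mapsto|i\rangle|A_i\rangle$, $|A_i\rangle=A_i/\|A_i\|$, for every nonzero row $A_i$ of $A$. Put $$R_\ell=I-2|t_\ell\rangle\langle t_\ell|,\qquad C(R_\ell)=R_\ell\otimes|0\rangle\langle 0|+I\otimes|1\rangle\langle 1|,\qquad z_\ell=\sqrt{\frac{|C_\ell|}{|C_{\ell-1}|}}\;C_\ell^{-1}e_\ell\in\mathbb{R}^\ell,\quad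 e_\ell=(0,\dots,0,1)^T .$$ Then $|t_\ell\rangle=\sum_{j=1}^{\ell}z_{j\ell}|s_j\rangle$, and there is a universal constant $K>0$, independent of $m,n,A,\ell,g,\varepsilon,U_A$, such that: (a) for every $\ell$ there is a straight-line arithmetic program (rational constants and the operations $+,-,\times,/,\sqrt{\cdot}$ on real numbers, together with accesses to the inner products $\langle A_{g(i)},A_{g(j)}\rangle$), depending only on $\ell$, that computes the vector $z_\ell$ with at most $K\ell^3$ operations and at most $K\ell^2$ inner products between rows of $A$; (b) for every $\varepsilon>0$ there is a quantum circuit, whose gates other than queries depend only on $m,n,\ell,g,\varepsilon$ and the coefficients $z_\ell$ (and not otherwise on $A$ or $U_A$), that makes at most $$K\,\ell\,\sigma_{\min}(C_\ell)^{-1/2}\,\varepsilon^{-1}$$ queries to $U_A$ or $U_A^\dagger$ and implements $C(R_\ell)$ within error $\varepsilon$ in operator norm, all auxiliary registers starting in, and being returned to, the state $|0\rangle$. -/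

import Mathlib

open scoped Matrix Kronecker

namespace QGSP

noncomputable section

/-! ### Rows, Gram matrices and Gram-Schmidt states -/

/-- The `i`-th row of `A` as a vector of Euclidean space. -/
def rowVec {m n : ℕ} (A : Matrix (Fin m) (Fin n) ℝ) (i : Fin m) : EuclideanSpace ℝ (Fin n) :=
  WithLp.toLp 2 (A i)

/-- The normalized row `|A_i⟩ = A_i / ‖A_i‖` (used for nonzero rows only). -/
def rowState {m n : ℕ} (A : Matrix (Fin m) (Fin n) ℝ) (i : Fin m) : EuclideanSpace ℝ (Fin n) :=
  ‖rowVec A i‖⁻¹ • rowVec A i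

/-- The Gram matrix with entries `⟨s_i | s_j⟩`, where `|s_i⟩ = |A_{g i}⟩`. -/
def gramMatrix {m n l : ℕ} (A : Matrix (Fin m) (Fin n) ℝ) (g : Fin l → Fin m) :
    Matrix (Fin l) (Fin l) ℝ :=
  Matrix.gram ℝ (fun i => rowState A (g i))

/-- The state `|t_l⟩`, `l = k + 1`: the last vector produced by the normalized Gram-Schmidt
process applied to `|s_1⟩, …, |s_l⟩`. -/
def orthoState {m n k : ℕ} (A : Matrix (Fin m) (Fin n) ℝ) (g : Fin (k + 1) → Fin m) :
    EuclideanSpace ℝ (Fin n) :=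
  InnerProductSpace.gramSchmidtNormed ℝ (fun i => rowState A (g i)) (Fin.last k)

/-- The least singular value of a square matrix of size `k + 1`. Mathlib's sequence of singular
values is decreasing and indexed from `0`. -/
def sigmaMin {k : ℕ} (C : Matrix (Fin (k + 1)) (Fin (k + 1)) ℝ) : ℝ :=
  (Matrix.toEuclideanLin C).singularValues k

/-- The vector `z_l = √(|C_l| / |C_{l-1}|) • C_l⁻¹ e_l`, `l = k + 1`. -/
def lcuCoeff {m n k : ℕ} (A : Matrix (Fin m) (Fin n) ℝ) (g : Fin (k + 1) → Fin m) :
    Fin (k + 1) → ℝ :=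
  √((gramMatrix A g).det / (gramMatrix A (fun i : Fin k => g i.castSucc)).det) •
    ((gramMatrix A g)⁻¹ *ᵥ Pi.single (Fin.last k) 1)

/-- The reflection `R = I - 2 |t⟩⟨t|` for a real vector `t`, as a complex matrix. -/
def reflection {n : ℕ} (t : EuclideanSpace ℝ (Fin n)) : Matrix (Fin n) (Fin n) ℂ :=
  1 - (2 : ℂ) • Matrix.vecMulVec (fun i => (t i : ℂ)) (star fun i => (t i : ℂ))

/-- The controlled reflection `C(R) = R ⊗ |0⟩⟨0| + I ⊗ |1⟩⟨1|`. -/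
def ctrlReflection {n : ℕ} (t : EuclideanSpace ℝ (Fin n)) :
    Matrix (Fin n × Fin 2) (Fin n × Fin 2) ℂ :=
  reflection t ⊗ₖ Matrix.single 0 0 1 +
    (1 : Matrix (Fin n) (Fin n) ℂ) ⊗ₖ Matrix.single 1 1 1

/-! ### Classical arithmetic programs with access to inner products of rows -/

/-- Instructions of a straight-line program over the reals that acts on registers numbered by `ℕ`.
The first argument is the register that is written. `inner d i j` is an access to the inner
product of the `i`-th and `j`-th selected rows. -/
inductive Instr (l : ℕ) : Type
  | const (d : ℕ) (q : ℚ)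
  | add (d a b : ℕ)
  | sub (d a b : ℕ)
  | mul (d a b : ℕ)
  | div (d a b : ℕ)
  | sqrt (d a : ℕ)
  | inner (d : ℕ) (i j : Fin l)

/-- Whether an instruction is an access to an inner product. -/
def Instr.isInner {l : ℕ} : Instr l → Bool
  | .inner _ _ _ => true
  | _ => false

/-- Effect of one instruction on the registers, `ip i j` being the inner product of the selected
rows `i` and `j`. Division by zero and the square root of a negative number fail. -/
def Instr.exec {l : ℕ} (ip : Fin l → Fin l → ℝ) (s : ℕ → ℝ) : Instr l → Option (ℕ → ℝ)
  | .const d q => some (Function.update s d (q : ℝ))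
  | .add d a b => some (Function.update s d (s a + s b))
  | .sub d a b => some (Function.update s d (s a - s b))
  | .mul d a b => some (Function.update s d (s a * s b))
  | .div d a b =>
      open scoped Classical in
      if s b = 0 then none else some (Function.update s d (s a / s b))
  | .sqrt d a =>
      open scoped Classical in
      if s a < 0 then none else some (Function.update s d √(s a))
  | .inner d i j => some (Function.update s d (ip i j))

/-- A straight-line program together with the registers that hold its output. -/
structure Program (l : ℕ) : Type where
  code : List (Instr l)
  out : Fin l → ℕ

/-- Number of classical operations other than accesses to inner products. -/
def Program.numOps {l : ℕ} (P : Program l) : ℕ := P.code.countP fun c => !c.isInner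

/-- Number of inner products between rows that are used. -/
def Program.numInner {l : ℕ} (P : Program l) : ℕ := P.code.countP fun c => c.isInner

/-- The output of the program on the rows `A_{g 1}, …, A_{g l}` (`none` if an instruction fails).
All registers hold `0` at the start. -/
def Program.run {l m n : ℕ} (P : Program l) (A : Matrix (Fin m) (Fin n) ℝ) (g : Fin l → Fin m) :
    Option (Fin l → ℝ) :=
  (P.code.foldlM
    (Instr.exec fun i j => Inner.inner ℝ (rowVec A (g i)) (rowVec A (g j)))
    (fun _ : ℕ => (0 : ℝ))).map fun s i => s (P.out i)

/-! ### Quantum circuits with queries to the row oracle -/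

/-- Basis of the whole system: row register and column register (on which the oracle acts),
control qubit, and a workspace of dimension `w + 1`. -/
abbrev Sys (m n w : ℕ) : Type := (Fin m × Fin n) × (Fin 2 × Fin (w + 1))

/-- `U` acts on the row and column registers as `|i⟩|0⟩ ↦ |i⟩|A_i⟩` for every nonzero row `A_i`.
Its action on other basis states is not prescribed. -/
def IsRowOracle {m n : ℕ} [NeZero n] (A : Matrix (Fin m) (Fin n) ℝ)
    (U : Matrix.unitaryGroup (Fin m × Fin n) ℂ) : Prop :=
  ∀ i, A i ≠ 0 → ∀ i' j,
    (U : Matrix (Fin m × Fin n) (Fin m × Fin n) ℂ) (i', j) (i, 0) =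
      if i' = i then (rowState A i j : ℂ) else 0

/-- One step of a circuit: a unitary gate that does not involve the oracle, or a query to the
oracle or to its inverse. -/
inductive Gate (m n w : ℕ) : Type
  | free (V : Matrix.unitaryGroup (Sys m n w) ℂ)
  | query
  | queryInv

/-- Whether a step is a query. -/
def Gate.isQuery {m n w : ℕ} : Gate m n w → Bool
  | .free _ => false
  | .query => true
  | .queryInv => true

/-- The matrix of a step, when the oracle is `U`. -/
def Gate.toMatrix {m n w : ℕ} (U : Matrix.unitaryGroup (Fin m × Fin n) ℂ) :
    Gate m n w → Matrix (Sys m n w) (Sys m n w) ℂ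
  | .free V => V
  | .query => (U : Matrix (Fin m × Fin n) (Fin m × Fin n) ℂ) ⊗ₖ 1
  | .queryInv => (U : Matrix (Fin m × Fin n) (Fin m × Fin n) ℂ)ᴴ ⊗ₖ 1

/-- A circuit: a workspace size and a list of steps, the first of which is applied first. -/
structure Circuit (m n : ℕ) : Type where
  w : ℕ
  gates : List (Gate m n w)

/-- Number of queries to the oracle or its inverse. -/
def Circuit.numQueries {m n : ℕ} (Q : Circuit m n) : ℕ := Q.gates.countP Gate.isQuery

/-- The matrix of a circuit, when the oracle is `U`. -/
def Circuit.toMatrix {m n : ℕ} (Q : Circuit m n) (U : Matrix.unitaryGroup (Fin m × Fin n) ℂ) :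
    Matrix (Sys m n Q.w) (Sys m n Q.w) ℂ :=
  Q.gates.foldl (fun M G => G.toMatrix U * M) 1

/-- The state `ψ` of the column register and the control qubit, with the row register and the
workspace in the state `|0⟩`. -/
def embed {m n : ℕ} [NeZero m] (w : ℕ) (ψ : Fin n × Fin 2 → ℂ) : Sys m n w → ℂ :=
  fun x => if x.1.1 = 0 ∧ x.2.2 = 0 then ψ (x.1.2, x.2.1) else 0

/-- With oracle `U`, the circuit implements the operator `T` on column register and control qubit
with error at most `ε` in operator norm, the other registers being returned to `|0⟩`. -/
def Circuit.Implements {m n : ℕ} [NeZero m] (Q : Circuit m n)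
    (U : Matrix.unitaryGroup (Fin m × Fin n) ℂ)
    (T : Matrix (Fin n × Fin 2) (Fin n × Fin 2) ℂ) (ε : ℝ) : Prop :=
  ∀ ψ : Fin n × Fin 2 → ℂ,
    ‖WithLp.toLp 2 (Q.toMatrix U *ᵥ embed Q.w ψ - embed Q.w (T *ᵥ ψ))‖ ≤ ε * ‖WithLp.toLp 2 ψ‖

end

end QGSP

namespace QGSP

/-! Let `l = k + 1`, let C be the Gram matrix of the normalized rows and z the coefficient vector.
The vector w with coefficients C⁻¹e_l is orthogonal to every s_i with i < l and pairs to 1 with s_l,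
so t_l is a nonnegative multiple of w. Since ‖w‖² = (C⁻¹)_{ll} = |C_{l-1}|/|C_l| by Cramer's rule,
the multiple is the stated square root (`gramSchmidtNormed_last`, `orthoState_eq_sum`). Moreover 1 =
‖t_l‖² = zᵀCz ≥ σ_min ‖z‖², which bounds ‖z‖ (`norm_lcuCoeff_le`).

For the classical part, C is inverted by pivoting at each diagonal position in turn. Positive
definiteness makes every pivot positive (`pivotStage_pivot_pos`), so no division fails, and each of
the l stages costs at most three operations per entry. `run_coeffProgram` is the correctness
statement.

For the quantum part, put a = √l ‖z‖. Preparing the row superposition with amplitudes z/‖z‖,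
querying once and undoing a uniform superposition yields t_l with amplitude 1/a. A rotated workspace
qubit lowers this amplitude to exactly sin(π/(4N+2)) with N = ⌈a⌉, so that N rounds of amplitude
amplification reach t_l without error (`amplification`). If V is the amplified preparation and D the
reflection about its initial state, then V D V† is the reflection about t_l with control 0 and all
other registers 0, which acts as C(R_l) (`gatesMatrix_reflectGates`, `exists_circuit`). The circuit
is thus exact and uses 4N + 2 = O(a) queries; the factor ε⁻¹ is affordable because for ε ≥ 2 the
empty circuit suffices. -/

/-! ### The last Gram–Schmidt vector and the inverse Gram matrix -/

theorem rowVec_ne_zero {m n : ℕ} {A : Matrix (Fin m) (Fin n) ℝ} {i : Fin m} (h : A i ≠ 0) :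
    rowVec A i ≠ 0 := by
  simpa [rowVec] using h

theorem linearIndependent_rowVec {m n l : ℕ} {A : Matrix (Fin m) (Fin n) ℝ} {g : Fin l → Fin m}
    (h : LinearIndependent ℝ fun i => A (g i)) : LinearIndependent ℝ fun i => rowVec A (g i) :=
  h.map' (WithLp.linearEquiv 2 ℝ (Fin n → ℝ)).symm.toLinearMap (LinearEquiv.ker _)

theorem linearIndependent_rowState {m n l : ℕ} {A : Matrix (Fin m) (Fin n) ℝ} {g : Fin l → Fin m}
    (h : LinearIndependent ℝ fun i => A (g i)) :
    LinearIndependent ℝ fun i => rowState A (g i) := by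
  have h1 := linearIndependent_rowVec h
  exact h1.units_smul fun i => Units.mk0 (‖rowVec A (g i)‖⁻¹)
    (inv_ne_zero (norm_ne_zero_iff.mpr (rowVec_ne_zero (h.ne_zero i))))

/-- The last diagonal entry of the inverse as a quotient of determinants. -/
theorem inv_last_last {k : ℕ} (C : Matrix (Fin (k + 1)) (Fin (k + 1)) ℝ) :
    C⁻¹ (Fin.last k) (Fin.last k) = (C.submatrix Fin.castSucc Fin.castSucc).det / C.det := by
  rw [Matrix.inv_def, Matrix.smul_apply, Matrix.adjugate_fin_succ_eq_det_submatrix]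
  simp [Ring.inverse_eq_inv', div_eq_inv_mul, ← two_mul, pow_mul]

section LastGramSchmidt

variable {E : Type*} [NormedAddCommGroup E] [InnerProductSpace ℝ E] {k : ℕ}

/-- Pairing `v i` with a combination of the `v j` applies the Gram matrix to the coefficients. The
column of the inverse therefore gives the dual vector of the last `v`. -/
theorem inner_sum_inv_gram {v : Fin (k + 1) → E} (hv : LinearIndependent ℝ v)
    (i : Fin (k + 1)) :
    inner ℝ (v i) (∑ j, ((Matrix.gram ℝ v)⁻¹ *ᵥ Pi.single (Fin.last k) 1) j • v j) =
      Pi.single (M := fun _ => ℝ) (Fin.last k) 1 i := by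
  have hC := (Matrix.posDef_gram_of_linearIndependent hv).det_pos.ne'
  have : (Matrix.gram ℝ v) *ᵥ ((Matrix.gram ℝ v)⁻¹ *ᵥ Pi.single (Fin.last k) 1) =
      Pi.single (Fin.last k) 1 := by
    rw [Matrix.mulVec_mulVec, Matrix.mul_nonsing_inv _ (isUnit_iff_ne_zero.mpr hC),
      Matrix.one_mulVec]
  generalize (Matrix.gram ℝ v)⁻¹ *ᵥ Pi.single (Fin.last k) 1 = x at this ⊢
  rw [← this, inner_sum]
  simp only [Matrix.mulVec, dotProduct, Matrix.gram_apply, inner_smul_right]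
  exact Finset.sum_congr rfl fun j _ => mul_comm _ _

/-- The last normalized Gram-Schmidt vector in terms of the inverse Gram matrix. -/
theorem gramSchmidtNormed_last {v : Fin (k + 1) → E} (hv : LinearIndependent ℝ v) :
    InnerProductSpace.gramSchmidtNormed ℝ v (Fin.last k) =
      ∑ j, (√((Matrix.gram ℝ v)⁻¹ (Fin.last k) (Fin.last k))⁻¹ •
        ((Matrix.gram ℝ v)⁻¹ *ᵥ Pi.single (Fin.last k) 1)) j • v j := by
  set C := Matrix.gram ℝ v
  set t := InnerProductSpace.gramSchmidtNormed ℝ v (Fin.last k) with ht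
  set x := C⁻¹ *ᵥ Pi.single (Fin.last k) 1 with hx
  set w := ∑ j, x j • v j with hw
  have hwi := inner_sum_inv_gram hv
  rw [← hx, ← hw] at hwi
  have hww : inner ℝ w w = C⁻¹ (Fin.last k) (Fin.last k) := by
    have hwy : ∀ y, inner ℝ w y = ∑ j, x j * inner ℝ (v j) y := fun y => by
      rw [hw, sum_inner]
      exact Finset.sum_congr rfl fun j _ => by rw [inner_smul_left, conj_trivial]
    rw [hwy]
    simp only [hwi]
    simp [hx, Pi.single_apply]
  have htn : ‖t‖ = 1 := InnerProductSpace.gramSchmidtNormed_unit_length _ hv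
  have hlt : ∀ i, i < Fin.last k → inner ℝ (v i) t = 0 := by
    intro i hi
    rw [real_inner_comm, ht, InnerProductSpace.gramSchmidtNormed, inner_smul_left,
      InnerProductSpace.gramSchmidt_inv_triangular ℝ v hi, mul_zero]
  have hspan : ∀ y ∈ Submodule.span ℝ (Set.range v), (∀ i, inner ℝ (v i) y = 0) → y = 0 := by
    intro y hy h
    have h2 : ∀ u ∈ Submodule.span ℝ (Set.range v), inner ℝ u y = 0 := by
      intro u hu
      induction hu using Submodule.span_induction with
      | mem u hu => obtain ⟨i, rfl⟩ := hu; exact h i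
      | zero => simp
      | add a b _ _ ha hb => rw [inner_add_left, ha, hb, add_zero]
      | smul c a _ ha => rw [inner_smul_left, ha, mul_zero]
    exact inner_self_eq_zero.mp (h2 y hy)
  have hts : t ∈ Submodule.span ℝ (Set.range v) := by
    rw [← InnerProductSpace.span_gramSchmidt ℝ v, ← InnerProductSpace.span_gramSchmidtNormed_range]
    exact Submodule.subset_span ⟨_, rfl⟩
  have hws : w ∈ Submodule.span ℝ (Set.range v) :=
    Submodule.sum_mem _ fun j _ => Submodule.smul_mem _ _ (Submodule.subset_span ⟨j, rfl⟩)
  set c := inner ℝ (v (Fin.last k)) t with hc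
  have htw : t = c • w := by
    -- Both vectors lie in the span and have the same inner products with every `v i`, so their
    -- difference is orthogonal to itself.
    refine sub_eq_zero.mp (hspan _ (Submodule.sub_mem _ hts (Submodule.smul_mem _ _ hws)) ?_)
    intro i
    rw [inner_sub_right, inner_smul_right, hwi]
    by_cases hi : i = Fin.last k
    · subst hi; simp [hc]
    · rw [hlt i (Fin.lt_last_iff_ne_last.mpr hi)]; simp [hi]
  -- This fixes the sign of the square root: the last `v` is its Gram–Schmidt residual plus a
  -- combination of earlier directions, all orthogonal to `t`.
  have hc0 : 0 ≤ c := by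
    have hgs := InnerProductSpace.gramSchmidt_def'' ℝ v (Fin.last k)
    rw [hc, hgs, inner_add_left, sum_inner, Finset.sum_eq_zero]
    · rw [add_zero, ht, InnerProductSpace.gramSchmidtNormed, inner_smul_right]
      exact mul_nonneg (by simp) real_inner_self_nonneg
    · intro i hi
      rw [ht, InnerProductSpace.gramSchmidtNormed, inner_smul_left, inner_smul_right,
        InnerProductSpace.gramSchmidt_orthogonal ℝ v (Finset.mem_Iio.mp hi).ne]
      simp
  have h1 : c ^ 2 * C⁻¹ (Fin.last k) (Fin.last k) = 1 := by
    have : inner ℝ t t = (1 : ℝ) := by rw [real_inner_self_eq_norm_sq, htn, one_pow]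
    rw [htw, inner_smul_left, inner_smul_right, hww] at this
    simpa [sq, mul_assoc] using this
  have hcv : c = √(C⁻¹ (Fin.last k) (Fin.last k))⁻¹ := by
    rw [← eq_inv_of_mul_eq_one_left h1, Real.sqrt_sq hc0]
  rw [← hcv, htw, hw, Finset.smul_sum]
  exact Finset.sum_congr rfl fun j _ => by simp [smul_smul]

end LastGramSchmidt

/-- Cramer's rule trades the determinants for a diagonal entry of the inverse, which is also what
the program has at hand after inverting. -/
theorem lcuCoeff_eq {m n k : ℕ} (A : Matrix (Fin m) (Fin n) ℝ) (g : Fin (k + 1) → Fin m) :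
    lcuCoeff A g = √((gramMatrix A g)⁻¹ (Fin.last k) (Fin.last k))⁻¹ •
      ((gramMatrix A g)⁻¹ *ᵥ Pi.single (Fin.last k) 1) := by
  rw [lcuCoeff, inv_last_last, inv_div]
  rfl

theorem orthoState_eq_sum {m n k : ℕ} {A : Matrix (Fin m) (Fin n) ℝ} {g : Fin (k + 1) → Fin m}
    (h : LinearIndependent ℝ fun i => A (g i)) :
    orthoState A g = ∑ j, lcuCoeff A g j • rowState A (g j) := by
  rw [lcuCoeff_eq]
  exact gramSchmidtNormed_last (linearIndependent_rowState h)

theorem norm_orthoState {m n k : ℕ} {A : Matrix (Fin m) (Fin n) ℝ} {g : Fin (k + 1) → Fin m}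
    (h : LinearIndependent ℝ fun i => A (g i)) : ‖orthoState A g‖ = 1 :=
  InnerProductSpace.gramSchmidtNormed_unit_length _ (linearIndependent_rowState h)

/-! ### The least singular value and the norm of the coefficient vector -/

/-- An eigenvector of `T` for `a` is one of `T* T` for `a ^ 2`, so `a ^ 2` is the square of some
singular value; positivity removes the squares, and the singular values decrease. -/
theorem singularValues_last_le_eigenvalues {E : Type*} [NormedAddCommGroup E]
    [InnerProductSpace ℝ E] [FiniteDimensional ℝ E] {T : E →ₗ[ℝ] E} (hT : T.IsPositive) {n : ℕ}
    (hn : Module.finrank ℝ E = n + 1) (i : Fin (n + 1)) :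
    T.singularValues n ≤ hT.isSymmetric.eigenvalues hn i := by
  set u := hT.isSymmetric.eigenvectorBasis hn i
  set a := hT.isSymmetric.eigenvalues hn i with ha
  have hu : T u = a • u := hT.isSymmetric.apply_eigenvectorBasis hn i
  have hadj : LinearMap.adjoint T = T := 
    (LinearMap.isSymmetric_iff_isSelfAdjoint T).mp hT.isSymmetric
  have hev : Module.End.HasEigenvalue (LinearMap.adjoint T ∘ₗ T) (a ^ 2) := by
    refine Module.End.hasEigenvalue_of_hasEigenvector (x := u)
      ⟨Module.End.mem_eigenspace_iff.mpr ?_, ?_⟩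
    · rw [hadj, LinearMap.comp_apply, hu, map_smul, hu, smul_smul, sq]
    · exact (hT.isSymmetric.eigenvectorBasis hn).orthonormal.ne_zero i
  obtain ⟨j, hj⟩ := T.isSymmetric_adjoint_comp_self.exists_eigenvalues_eq hn hev
  have h2 : T.singularValues j ^ 2 = a ^ 2 := by
    rw [T.sq_singularValues_fin hn j]; exact hj
  have h3 : T.singularValues n ≤ T.singularValues j :=
    T.singularValues_antitone (Nat.lt_succ_iff.mp j.2)
  have h4 : T.singularValues j = a :=
    (sq_eq_sq₀ (T.singularValues_nonneg _) (hT.nonneg_eigenvalues hn i)).mp h2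
  exact h4 ▸ h3

theorem singularValues_last_mul_norm_sq_le {E : Type*} [NormedAddCommGroup E]
    [InnerProductSpace ℝ E] [FiniteDimensional ℝ E] {T : E →ₗ[ℝ] E} (hT : T.IsPositive) {n : ℕ}
    (hn : Module.finrank ℝ E = n + 1) (x : E) :
    T.singularValues n * ‖x‖ ^ 2 ≤ inner ℝ x (T x) := by
  set b := hT.isSymmetric.eigenvectorBasis hn
  rw [← b.sum_inner_mul_inner x (T x), ← b.sum_sq_norm_inner_right x, Finset.mul_sum]
  refine Finset.sum_le_sum fun i _ => ?_
  rw [← hT.isSymmetric (b i) x, hT.isSymmetric.apply_eigenvectorBasis hn i, inner_smul_left,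
    Real.norm_eq_abs, sq_abs, real_inner_comm (b i) x]
  have := mul_le_mul_of_nonneg_right (singularValues_last_le_eigenvalues hT hn i)
    (sq_nonneg (inner ℝ (b i) x))
  simp only [RCLike.ofReal_real_eq_id, id, conj_trivial]
  linarith

theorem gramMatrix_posDef {m n l : ℕ} {A : Matrix (Fin m) (Fin n) ℝ} {g : Fin l → Fin m}
    (h : LinearIndependent ℝ fun i => A (g i)) : (gramMatrix A g).PosDef :=
  Matrix.posDef_gram_of_linearIndependent (linearIndependent_rowState h)

theorem sigmaMin_pos {k : ℕ} {C : Matrix (Fin (k + 1)) (Fin (k + 1)) ℝ} (hC : C.PosDef) :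
    0 < sigmaMin C := by
  have hinj : Function.Injective (Matrix.toEuclideanLin C) := by
    rw [← LinearMap.ker_eq_bot, LinearMap.ker_eq_bot']
    intro x hx
    have h1 : C *ᵥ x.ofLp = 0 := by
      simpa [Matrix.toLpLin_apply] using hx
    have := Matrix.eq_zero_of_mulVec_eq_zero hC.det_pos.ne' h1
    ext i; simp [this]
  exact (LinearMap.injective_iff_forall_lt_finrank_singularValues_pos _).mp hinj k (by simp)

theorem sigmaMin_mul_norm_sq_le {k : ℕ} {C : Matrix (Fin (k + 1)) (Fin (k + 1)) ℝ}
    (hC : C.PosDef) (x : Fin (k + 1) → ℝ) :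
    sigmaMin C * ‖WithLp.toLp 2 x‖ ^ 2 ≤ x ⬝ᵥ C *ᵥ x := by
  have hT : (Matrix.toEuclideanLin C).IsPositive :=
    Matrix.isPositive_toEuclideanLin_iff.mpr hC.posSemidef
  have := singularValues_last_mul_norm_sq_le hT (n := k) (by simp) (WithLp.toLp 2 x)
  refine this.trans_eq ?_
  simp [Matrix.toLpLin_apply, PiLp.inner_apply, dotProduct, mul_comm]

/-- The quadratic form of the Gram matrix at the coefficients is the squared norm of the unit vector
`orthoState A g`, and it dominates `sigmaMin` times the squared norm of the coefficients. -/
theorem norm_lcuCoeff_le {m n k : ℕ} {A : Matrix (Fin m) (Fin n) ℝ} {g : Fin (k + 1) → Fin m}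
    (h : LinearIndependent ℝ fun i => A (g i)) :
    ‖WithLp.toLp 2 (lcuCoeff A g)‖ ≤ sigmaMin (gramMatrix A g) ^ (-(1 / 2) : ℝ) := by
  have hs := sigmaMin_pos (gramMatrix_posDef h)
  have h1 := sigmaMin_mul_norm_sq_le (gramMatrix_posDef h) (lcuCoeff A g)
  have h2 : lcuCoeff A g ⬝ᵥ gramMatrix A g *ᵥ lcuCoeff A g = 1 := by
    have := Matrix.star_dotProduct_gram_mulVec (𝕜 := ℝ) (fun i => rowState A (g i))
      (lcuCoeff A g) (lcuCoeff A g)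
    rw [star_trivial, ← orthoState_eq_sum h, real_inner_self_eq_norm_sq, norm_orthoState h,
      one_pow] at this
    exact this
  rw [h2] at h1
  rw [Real.rpow_neg hs.le, ← Real.sqrt_eq_rpow, ← Real.sqrt_inv]
  exact Real.le_sqrt_of_sq_le (by rw [inv_eq_one_div, le_div_iff₀ hs]; linarith)

/-- Triangle inequality for a unit vector written in unit vectors, then Cauchy–Schwarz. It allows
additive constants in the query count to be absorbed. -/
theorem one_le_sqrt_mul_norm_lcuCoeff {m n k : ℕ} {A : Matrix (Fin m) (Fin n) ℝ}
    {g : Fin (k + 1) → Fin m} (h : LinearIndependent ℝ fun i => A (g i)) :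
    1 ≤ √(k + 1) * ‖WithLp.toLp 2 (lcuCoeff A g)‖ := by
  have h1 : (1 : ℝ) ≤ ∑ j, |lcuCoeff A g j| := by
    rw [← norm_orthoState h, orthoState_eq_sum h]
    refine (norm_sum_le _ _).trans (Finset.sum_le_sum fun j _ => ?_)
    rw [norm_smul, Real.norm_eq_abs, rowState, norm_smul, norm_inv, norm_norm,
      inv_mul_cancel₀ (norm_ne_zero_iff.mpr (rowVec_ne_zero (h.ne_zero j))), mul_one]
  have h2 := Real.sum_mul_le_sqrt_mul_sqrt Finset.univ (fun _ : Fin (k + 1) => (1 : ℝ))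
    (fun j => |lcuCoeff A g j|)
  rw [EuclideanSpace.norm_eq]
  simp at h2 ⊢
  exact h1.trans h2


/-! ### Inversion of a positive definite matrix by principal pivoting -/

/-- The principal pivot transform of `M` at the position `(p, p)`. -/
noncomputable def pivotTransform {l : ℕ} (p : Fin l) (M : Matrix (Fin l) (Fin l) ℝ) :
    Matrix (Fin l) (Fin l) ℝ :=
  Matrix.of fun i j =>
    -- Negation is written as `0 - _` and the reciprocal as `1 / _` to match the available
    -- instructions literally.
    if i = p then if j = p then 1 / M p p else (0 - M p j) / M p p
    else if j = p then M i p / M p p else M i j - M i p * M p j / M p p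

/-- Solving the `p`-th equation for `u p` and substituting into the others exchanges the `p`-th
input with the `p`-th output. -/
theorem pivotTransform_mulVec {l : ℕ} {p : Fin l} {M : Matrix (Fin l) (Fin l) ℝ}
    (hp : M p p ≠ 0) (u : Fin l → ℝ) :
    pivotTransform p M *ᵥ Function.update u p ((M *ᵥ u) p) =
      Function.update (M *ᵥ u) p (u p) := by
  have key : ∀ i, (M *ᵥ u) i = M i p * u p + ∑ j ∈ Finset.univ.erase p, M i j * u j := fun i =>
    (Finset.add_sum_erase _ _ (Finset.mem_univ p)).symm
  ext i
  rw [Matrix.mulVec, dotProduct, ← Finset.add_sum_erase _ _ (Finset.mem_univ p)]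
  have hsum : ∑ j ∈ Finset.univ.erase p,
      pivotTransform p M i j * Function.update u p ((M *ᵥ u) p) j =
      ∑ j ∈ Finset.univ.erase p, (if i = p then (0 - M p j) / M p p
        else M i j - M i p * M p j / M p p) * u j := by
    refine Finset.sum_congr rfl fun j hj => ?_
    have hj' := Finset.ne_of_mem_erase hj
    simp [pivotTransform, hj']
  rw [hsum, Function.update_self, key p]
  by_cases hi : i = p
  · subst hi
    have : ∑ j ∈ Finset.univ.erase i, (0 - M i j) / M i i * u j =
        -(∑ j ∈ Finset.univ.erase i, M i j * u j) / M i i := by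
      rw [neg_div, Finset.sum_div, ← Finset.sum_neg_distrib]
      exact Finset.sum_congr rfl fun j _ => by ring
    simp only [if_true, this, Function.update_self]
    simp only [pivotTransform, Matrix.of_apply, if_true]
    field_simp
    ring
  · have : ∑ j ∈ Finset.univ.erase p, (M i j - M i p * M p j / M p p) * u j =
        ∑ j ∈ Finset.univ.erase p, M i j * u j -
          M i p / M p p * ∑ j ∈ Finset.univ.erase p, M p j * u j := by
      rw [Finset.mul_sum, ← Finset.sum_sub_distrib]
      exact Finset.sum_congr rfl fun j _ => by ring
    simp only [if_neg hi, this, Function.update_of_ne hi, key i]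
    simp only [pivotTransform, Matrix.of_apply, if_true, if_neg hi]
    field_simp
    ring

/-- The result of pivoting at the first `p` diagonal positions in turn. -/
noncomputable def pivotStage {k : ℕ} (C : Matrix (Fin (k + 1)) (Fin (k + 1)) ℝ) :
    ℕ → Matrix (Fin (k + 1)) (Fin (k + 1)) ℝ
  | 0 => C
  | p + 1 => pivotTransform (Fin.ofNat (k + 1) p) (pivotStage C p)

/-- The vector with the first `p` entries of `a` and the remaining entries of `b`. -/
def splice {l : ℕ} (p : ℕ) (a b : Fin l → ℝ) : Fin l → ℝ := fun i => if i.val < p then a i else b i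

theorem splice_succ {k p : ℕ} (hp : p < k + 1) (a b : Fin (k + 1) → ℝ) :
    splice (p + 1) a b =
      Function.update (splice p a b) (Fin.ofNat (k + 1) p) (a (Fin.ofNat (k + 1) p)) := by
  ext i
  by_cases hi : i = Fin.ofNat (k + 1) p
  · subst hi
    simp [splice, Nat.mod_eq_of_lt hp]
  · have h : i.val ≠ p := fun h => hi (Fin.ext (by simp [Nat.mod_eq_of_lt hp, h]))
    rw [Function.update_of_ne hi, splice, splice]
    exact if_congr (by omega) rfl rfl

theorem dotProduct_mulVec_pos {l : ℕ} {C : Matrix (Fin l) (Fin l) ℝ} (hC : C.PosDef)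
    {x : Fin l → ℝ} (hx : x ≠ 0) : 0 < ∑ i, x i * (C *ᵥ x) i := by
  simpa [dotProduct] using hC.dotProduct_mulVec_pos hx

/-- In finite dimension injectivity suffices. If the splice vanishes, each `i` has `x i = 0` or `(C
*ᵥ x) i = 0`, so the quadratic form vanishes at `x`. -/
theorem splice_surjective {l : ℕ} {C : Matrix (Fin l) (Fin l) ℝ} (hC : C.PosDef) (p : ℕ) :
    Function.Surjective fun x : Fin l → ℝ => splice p (C *ᵥ x) x := by
  let L : (Fin l → ℝ) →ₗ[ℝ] (Fin l → ℝ) :=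
    { toFun := fun x => splice p (C *ᵥ x) x
      map_add' := fun x y => by
        ext i; simp only [splice, Matrix.mulVec_add, Pi.add_apply]; split_ifs <;> rfl
      map_smul' := fun c x => by
        ext i; simp only [splice, Matrix.mulVec_smul, Pi.smul_apply, RingHom.id_apply]
        split_ifs <;> rfl }
  refine (LinearMap.injective_iff_surjective (f := L)).mp ?_
  refine (injective_iff_map_eq_zero L).mpr fun x hx => ?_
  by_contra hne
  refine (dotProduct_mulVec_pos hC hne).ne' (Finset.sum_eq_zero fun i _ => ?_)
  have hi : splice p (C *ᵥ x) x i = 0 := congrFun hx i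
  rw [splice] at hi
  split_ifs at hi <;> simp [hi]

/-- Choose `x` whose splice is the basis vector at the pivot. All terms of the quadratic form of `C`
at `x` vanish except the pivot term, which equals the pivot, so the pivot inherits positivity. -/
theorem pivot_pos_of_splice {k p : ℕ} (hp : p < k + 1)
    {C M : Matrix (Fin (k + 1)) (Fin (k + 1)) ℝ} (hC : C.PosDef)
    (hM : ∀ x, M *ᵥ splice p (C *ᵥ x) x = splice p x (C *ᵥ x)) :
    0 < M (Fin.ofNat (k + 1) p) (Fin.ofNat (k + 1) p) := by
  set q := Fin.ofNat (k + 1) p with hq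
  have hqp : q.val = p := by simp [hq, Nat.mod_eq_of_lt hp]
  obtain ⟨x, hx⟩ := splice_surjective hC p (Pi.single q 1)
  have hx' : splice p (C *ᵥ x) x = Pi.single q 1 := hx
  have h1 : M q q = (C *ᵥ x) q := by
    have := congrFun (hM x) q
    rw [hx'] at this
    simpa [splice, hqp] using this
  have hxq : x q = 1 := by
    have := congrFun hx' q
    simpa [splice, hqp] using this
  have hne : x ≠ 0 := fun h => by simp [h] at hxq
  have h2 := dotProduct_mulVec_pos hC hne
  rw [Finset.sum_eq_single q] at h2
  · rwa [h1, ← one_mul ((C *ᵥ x) q), ← hxq]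
  · intro i _ hi
    have := congrFun hx' i
    rw [splice, Pi.single_eq_of_ne hi] at this
    split_ifs at this <;> simp [this]
  · simp

/-- Invariant of the elimination: after `p` pivots the first `p` inputs and outputs of `C` have been
exchanged. At `p = k + 1` this says that `C *ᵥ x` is sent to `x`. -/
theorem pivotStage_mulVec {k : ℕ} {C : Matrix (Fin (k + 1)) (Fin (k + 1)) ℝ} (hC : C.PosDef) :
    ∀ p ≤ k + 1, ∀ x, pivotStage C p *ᵥ splice p (C *ᵥ x) x = splice p x (C *ᵥ x)
  | 0, _, x => by
    have hs : ∀ a b : Fin (k + 1) → ℝ, splice 0 a b = b := fun a b => by ext i; simp [splice]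
    rw [hs, hs, pivotStage]
  | p + 1, hp, x => by
    have ih := pivotStage_mulVec hC p (by omega)
    have hpos := pivot_pos_of_splice (by omega) hC ih
    have hv : ∀ a b : Fin (k + 1) → ℝ,
        splice p a b (Fin.ofNat (k + 1) p) = b (Fin.ofNat (k + 1) p) := fun a b => by
      simp [splice, Nat.mod_eq_of_lt (show p < k + 1 by omega)]
    have h := pivotTransform_mulVec hpos.ne' (splice p (C *ᵥ x) x)
    rw [ih x, hv, hv] at h
    rw [splice_succ (by omega), splice_succ (by omega)]
    exact h

theorem pivotStage_pivot_pos {k p : ℕ} {C : Matrix (Fin (k + 1)) (Fin (k + 1)) ℝ}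
    (hC : C.PosDef) (hp : p < k + 1) :
    0 < pivotStage C p (Fin.ofNat (k + 1) p) (Fin.ofNat (k + 1) p) :=
  pivot_pos_of_splice hp hC (pivotStage_mulVec hC p hp.le)

theorem pivotStage_last {k : ℕ} {C : Matrix (Fin (k + 1)) (Fin (k + 1)) ℝ} (hC : C.PosDef) :
    pivotStage C (k + 1) = C⁻¹ := by
  refine (Matrix.inv_eq_left_inv (Matrix.ext_of_mulVec_single fun j => ?_)).symm
  have h := pivotStage_mulVec hC (k + 1) le_rfl (Pi.single j 1)
  have hs : ∀ a b : Fin (k + 1) → ℝ, splice (k + 1) a b = a := fun a b => by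
    ext i; simp [splice, i.isLt]
  rw [hs, hs] at h
  rw [← Matrix.mulVec_mulVec, h, Matrix.one_mulVec]

/-! ### A calculus for straight-line programs -/

/-- Labels of registers. -/
abbrev Label (l : ℕ) : Type := ℕ × ℕ × Fin l × Fin l

/-- The register with a given label. -/
def reg {l : ℕ} (r : Label l) : ℕ := Encodable.encode r

theorem reg_injective {l : ℕ} : Function.Injective (reg (l := l)) := Encodable.encode_injective

/-- Run on registers that agree with `val` on `W`, the code does not fail and the registers agree
with `val` on `W'` afterwards. -/
def Computes {l : ℕ} (ip : Fin l → Fin l → ℝ) (val : Label l → ℝ) (W : Set (Label l))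
    (c : List (Instr l)) (W' : Set (Label l)) : Prop :=
  ∀ s : ℕ → ℝ, (∀ r ∈ W, s (reg r) = val r) →
    ∃ s', c.foldlM (Instr.exec ip) s = some s' ∧ ∀ r ∈ W', s' (reg r) = val r

section Computes

variable {l : ℕ} {ip : Fin l → Fin l → ℝ} {val : Label l → ℝ} {W W' W'' : Set (Label l)}
  {c c' : List (Instr l)}

theorem Computes.nil (h : W' ⊆ W) : Computes ip val W [] W' :=
  fun s hs => ⟨s, rfl, fun r hr => hs r (h hr)⟩

theorem Computes.append (h : Computes ip val W c W') (h' : Computes ip val W' c' W'') :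
    Computes ip val W (c ++ c') W'' := by
  intro s hs
  obtain ⟨s', h1, h2⟩ := h s hs
  obtain ⟨s'', h3, h4⟩ := h' s' h2
  exact ⟨s'', by rw [List.foldlM_append, h1]; exact h3, h4⟩

theorem Computes.mono (h : Computes ip val W c W') (h' : W'' ⊆ W') : Computes ip val W c W'' := by
  intro s hs
  obtain ⟨s', h1, h2⟩ := h s hs
  exact ⟨s', h1, fun r hr => h2 r (h' hr)⟩

/-- A label has one intended value for the whole run, so a correct write only enlarges the set of
correct registers; injectivity of `reg` protects the others. -/
theorem Computes.single {i : Instr l} {d : Label l}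
    (h : ∀ s : ℕ → ℝ, (∀ r ∈ W, s (reg r) = val r) →
      i.exec ip s = some (Function.update s (reg d) (val d))) :
    Computes ip val W [i] (insert d W) := by
  intro s hs
  refine ⟨_, by simpa using h s hs, fun r hr => ?_⟩
  by_cases hrd : r = d
  · subst hrd; simp
  · rw [Function.update_of_ne (reg_injective.ne hrd)]
    exact hs r (hr.resolve_left hrd)

theorem Computes.const {d : Label l} {q : ℚ} (h : val d = q) :
    Computes ip val W [.const (reg d) q] (insert d W) :=
  .single fun s _ => by simp [Instr.exec, h]

theorem Computes.inner {d : Label l} {i j : Fin l} (h : val d = ip i j) :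
    Computes ip val W [.inner (reg d) i j] (insert d W) :=
  .single fun s _ => by simp [Instr.exec, h]

theorem Computes.sub {d a b : Label l} (h : val d = val a - val b) (ha : a ∈ W) (hb : b ∈ W) :
    Computes ip val W [.sub (reg d) (reg a) (reg b)] (insert d W) :=
  .single fun s hs => by simp [Instr.exec, h, hs a ha, hs b hb]

theorem Computes.mul {d a b : Label l} (h : val d = val a * val b) (ha : a ∈ W) (hb : b ∈ W) :
    Computes ip val W [.mul (reg d) (reg a) (reg b)] (insert d W) :=
  .single fun s hs => by simp [Instr.exec, h, hs a ha, hs b hb]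

theorem Computes.div {d a b : Label l} (h : val d = val a / val b) (h0 : val b ≠ 0) (ha : a ∈ W)
    (hb : b ∈ W) : Computes ip val W [.div (reg d) (reg a) (reg b)] (insert d W) :=
  .single fun s hs => by simp [Instr.exec, h, hs a ha, hs b hb, h0]

theorem Computes.sqrt {d a : Label l} (h : val d = √(val a)) (h0 : 0 ≤ val a) (ha : a ∈ W) :
    Computes ip val W [.sqrt (reg d) (reg a)] (insert d W) :=
  .single fun s hs => by simp [Instr.exec, h, hs a ha, h0.not_gt]

/-- The hypothesis ranges over all larger `W'` because earlier iterations have already added their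
outputs. -/
theorem Computes.flatMap {ι : Type*} {f : ι → List (Instr l)} {d : ι → Label l} :
    ∀ {L : List ι} {W : Set (Label l)},
      (∀ i ∈ L, ∀ W', W ⊆ W' → Computes ip val W' (f i) (insert (d i) W')) →
      Computes ip val W (L.flatMap f) (W ∪ {r | ∃ i ∈ L, r = d i})
  | [], W, _ => .nil (by simp)
  | i :: L, W, h => by
    rw [List.flatMap_cons]
    refine (Computes.append (h i (by simp) W subset_rfl)
      (Computes.flatMap (L := L) fun j hj W' hW' =>
        h j (by simp [hj]) W' ((Set.subset_insert _ _).trans hW'))).mono ?_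
    rintro r (hr | ⟨j, hj, rfl⟩)
    · exact Or.inl (Or.inr hr)
    · rcases List.mem_cons.mp hj with rfl | hj
      · exact Or.inl (Or.inl rfl)
      · exact Or.inr ⟨j, hj, rfl⟩

end Computes

/-! ### The program for the coefficients -/

/-- The intended contents of the labelled registers. -/
noncomputable def regVal {k : ℕ} (ip : Fin (k + 1) → Fin (k + 1) → ℝ)
    (C : Matrix (Fin (k + 1)) (Fin (k + 1)) ℝ) : Label (k + 1) → ℝ
  | (0, p, i, j) => pivotStage C p i j
  | (1, _, i, j) => ip i j
  | (2, _, i, _) => √(ip i i)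
  | (3, _, i, j) => √(ip i i) * √(ip j j)
  | (4, _) => 1
  | (5, _) => 0
  | (6, p, i, j) => 0 - pivotStage C p i j
  | (7, p, i, j) =>
      pivotStage C p i (Fin.ofNat (k + 1) p) * pivotStage C p (Fin.ofNat (k + 1) p) j
  | (8, p, i, j) =>
      pivotStage C p i (Fin.ofNat (k + 1) p) * pivotStage C p (Fin.ofNat (k + 1) p) j /
        pivotStage C p (Fin.ofNat (k + 1) p) (Fin.ofNat (k + 1) p)
  | (9, _) => 1 / pivotStage C (k + 1) (Fin.last k) (Fin.last k)
  | (10, _) => √(1 / pivotStage C (k + 1) (Fin.last k) (Fin.last k))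
  -- The code uses this default case only with tag 11, the output registers.
  | (_, _, i, _) =>
      √(1 / pivotStage C (k + 1) (Fin.last k) (Fin.last k)) *
        pivotStage C (k + 1) i (Fin.last k)

/-- All pairs of indices. -/
def indexPairs (k : ℕ) : List (Fin (k + 1) × Fin (k + 1)) :=
  (List.finRange (k + 1)).product (List.finRange (k + 1))

/-- Access to all inner products. -/
def accessCode (k : ℕ) : List (Instr (k + 1)) :=
  (indexPairs k).flatMap fun x => [.inner (reg (1, 0, x.1, x.2)) x.1 x.2]

/-- Computation of the norms. -/
def normCode (k : ℕ) : List (Instr (k + 1)) :=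
  (List.finRange (k + 1)).flatMap fun i => [.sqrt (reg (2, 0, i, i)) (reg (1, 0, i, i))]

/-- Normalization of the inner products. -/
def gramCode (k : ℕ) : List (Instr (k + 1)) :=
  (indexPairs k).flatMap fun x =>
    [.mul (reg (3, 0, x.1, x.2)) (reg (2, 0, x.1, x.1)) (reg (2, 0, x.2, x.2)),
      .div (reg (0, 0, x.1, x.2)) (reg (1, 0, x.1, x.2)) (reg (3, 0, x.1, x.2))]

/-- The constants `1` and `0`. -/
def constCode (k : ℕ) : List (Instr (k + 1)) :=
  [.const (reg (l := k + 1) (4, 0, 0, 0)) 1, .const (reg (l := k + 1) (5, 0, 0, 0)) 0]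

/-- One entry of a principal pivot transform with pivot `q`. -/
def pivotEntryCode {k : ℕ} (p : ℕ) (q i j : Fin (k + 1)) : List (Instr (k + 1)) :=
  if i = q then
    if j = q then [.div (reg (0, p + 1, i, j)) (reg (l := k + 1) (4, 0, 0, 0)) (reg (0, p, q, q))]
    else [.sub (reg (6, p, q, j)) (reg (l := k + 1) (5, 0, 0, 0)) (reg (0, p, q, j)),
      .div (reg (0, p + 1, i, j)) (reg (6, p, q, j)) (reg (0, p, q, q))]
  else
    if j = q then [.div (reg (0, p + 1, i, j)) (reg (0, p, i, q)) (reg (0, p, q, q))]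
    else [.mul (reg (7, p, i, j)) (reg (0, p, i, q)) (reg (0, p, q, j)),
      .div (reg (8, p, i, j)) (reg (7, p, i, j)) (reg (0, p, q, q)),
      .sub (reg (0, p + 1, i, j)) (reg (0, p, i, j)) (reg (8, p, i, j))]

/-- The first `p` principal pivot transforms. -/
def pivotCode (k p : ℕ) : List (Instr (k + 1)) :=
  (List.range p).flatMap fun p => (indexPairs k).flatMap fun x =>
    pivotEntryCode p (Fin.ofNat (k + 1) p) x.1 x.2

/-- Scaling of the last column of the inverse. -/
def scaleCode (k : ℕ) : List (Instr (k + 1)) :=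
  [.div (reg (l := k + 1) (9, 0, 0, 0)) (reg (l := k + 1) (4, 0, 0, 0))
      (reg (0, k + 1, Fin.last k, Fin.last k)),
    .sqrt (reg (l := k + 1) (10, 0, 0, 0)) (reg (l := k + 1) (9, 0, 0, 0))] ++
  (List.finRange (k + 1)).flatMap fun j =>
    [.mul (reg (11, 0, j, 0)) (reg (l := k + 1) (10, 0, 0, 0)) (reg (0, k + 1, j, Fin.last k))]

/-- The program that computes the coefficients. -/
def coeffProgram (k : ℕ) : Program (k + 1) where
  code := accessCode k ++ (normCode k ++ (gramCode k ++ (constCode k ++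
    (pivotCode k (k + 1) ++ scaleCode k))))
  out j := reg (11, 0, j, 0)

theorem mem_indexPairs {k : ℕ} (x : Fin (k + 1) × Fin (k + 1)) : x ∈ indexPairs k := by
  exact List.pair_mem_product.mpr ⟨List.mem_finRange _, List.mem_finRange _⟩

theorem length_indexPairs (k : ℕ) : (indexPairs k).length = (k + 1) * (k + 1) := by
  exact (List.length_product _ _).trans (by rw [List.length_finRange])

theorem isInner_pivotEntryCode {k p : ℕ} {q i j : Fin (k + 1)} :
    ∀ c ∈ pivotEntryCode p q i j, c.isInner = false := by
  intro c hc
  unfold pivotEntryCode at hc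
  split_ifs at hc <;> simp at hc <;> grind [Instr.isInner]

theorem length_pivotEntryCode_le {k p : ℕ} {q i j : Fin (k + 1)} :
    (pivotEntryCode p q i j).length ≤ 3 := by
  unfold pivotEntryCode
  split_ifs <;> simp

theorem length_flatMap_le {ι α : Type*} {L : List ι} {f : ι → List α} {b : ℕ}
    (h : ∀ i ∈ L, (f i).length ≤ b) : (L.flatMap f).length ≤ L.length * b := by
  rw [List.length_flatMap]
  simpa using List.sum_le_card_nsmul (L.map fun i => (f i).length) b (by simpa using h)

theorem length_pivotCode_le (k p : ℕ) :
    (pivotCode k p).length ≤ p * ((k + 1) * (k + 1) * 3) := by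
  refine (length_flatMap_le (b := (k + 1) * (k + 1) * 3) fun p _ => ?_).trans_eq (by simp)
  rw [← length_indexPairs]
  exact length_flatMap_le fun x _ => length_pivotEntryCode_le

theorem length_code_coeffProgram_le (k : ℕ) :
    (coeffProgram k).code.length ≤ 12 * (k + 1) ^ 3 := by
  have h := length_pivotCode_le k (k + 1)
  have h1 : (accessCode k).length ≤ (k + 1) * (k + 1) * 1 := by
    rw [← length_indexPairs]; exact length_flatMap_le fun _ _ => by simp
  have h2 : (normCode k).length ≤ (k + 1) * 1 := by
    simp [normCode]
  have h3 : (gramCode k).length ≤ (k + 1) * (k + 1) * 2 := by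
    rw [← length_indexPairs]; exact length_flatMap_le fun _ _ => by simp
  have h4 : (scaleCode k).length ≤ 2 + (k + 1) * 1 := by
    simp [scaleCode, List.length_flatMap]; omega
  have h5 : (constCode k).length = 2 := rfl
  simp only [coeffProgram, List.length_append]
  -- With l = k + 1 the total is at most 3l³ + 3l² + 2l + 4, and l ≥ 1.
  nlinarith [Nat.zero_le k, Nat.zero_le (k ^ 2), Nat.zero_le (k ^ 3)]

theorem numOps_coeffProgram_le (k : ℕ) : (coeffProgram k).numOps ≤ 12 * (k + 1) ^ 3 :=
  List.countP_le_length.trans (length_code_coeffProgram_le k)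

theorem numInner_coeffProgram_le (k : ℕ) : (coeffProgram k).numInner ≤ (k + 1) ^ 2 := by
  have h1 : (accessCode k).countP (fun c => c.isInner) ≤ (k + 1) * (k + 1) * 1 := by
    refine List.countP_le_length.trans ?_
    rw [← length_indexPairs]; exact length_flatMap_le fun _ _ => by simp
  have h2 : (normCode k ++ (gramCode k ++ (constCode k ++
      (pivotCode k (k + 1) ++ scaleCode k)))).countP (fun c => c.isInner) = 0 := by
    rw [List.countP_eq_zero]
    intro c hc
    rw [Bool.not_eq_true]
    simp only [List.mem_append, normCode, gramCode, constCode, pivotCode, scaleCode,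
      List.mem_flatMap, List.mem_cons, List.not_mem_nil, or_false] at hc
    rcases hc with ⟨_, _, rfl⟩ | ⟨_, _, rfl | rfl⟩ | (rfl | rfl) | ⟨_, _, _, _, h⟩ |
      (rfl | rfl) | ⟨_, _, rfl⟩
    all_goals first | rfl | exact isInner_pivotEntryCode c h
  simp only [Program.numInner, coeffProgram]
  rw [List.countP_append, h2]
  nlinarith

section Correctness

variable {k : ℕ} {ip : Fin (k + 1) → Fin (k + 1) → ℝ}
  {C : Matrix (Fin (k + 1)) (Fin (k + 1)) ℝ} {W : Set (Label (k + 1))}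

theorem computes_accessCode : Computes ip (regVal ip C) W (accessCode k)
    (W ∪ {r | ∃ x ∈ indexPairs k, r = (1, 0, x.1, x.2)}) :=
  .flatMap fun _ _ _ _ => .inner rfl

theorem computes_normCode (hip : ∀ i, 0 < ip i i) (hW : ∀ i j, (1, 0, i, j) ∈ W) :
    Computes ip (regVal ip C) W (normCode k)
      (W ∪ {r | ∃ i ∈ List.finRange (k + 1), r = (2, 0, i, i)}) :=
  .flatMap fun i _ _ h => .sqrt rfl (hip i).le (h (hW i i))

theorem computes_gramCode (hip : ∀ i, 0 < ip i i)
    (hC : ∀ i j, C i j = ip i j / (√(ip i i) * √(ip j j)))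
    (hW : ∀ i j, (1, 0, i, j) ∈ W) (hW' : ∀ i, (2, 0, i, i) ∈ W) :
    Computes ip (regVal ip C) W (gramCode k)
      (W ∪ {r | ∃ x ∈ indexPairs k, r = (0, 0, x.1, x.2)}) := by
  refine .flatMap fun x _ V h => ?_
  refine (Computes.append (c := [_]) (c' := [_])
    (.mul (d := (3, 0, x.1, x.2)) rfl (h (hW' x.1)) (h (hW' x.2)))
    (.div (d := (0, 0, x.1, x.2)) (hC _ _) ?_ (Or.inr (h (hW _ _))) (Or.inl rfl))).mono ?_
  · exact (mul_pos (Real.sqrt_pos.mpr (hip _)) (Real.sqrt_pos.mpr (hip _))).ne'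
  · exact Set.insert_subset_insert (Set.subset_insert _ _)

theorem computes_constCode : Computes ip (regVal ip C) W (constCode k)
    (insert (5, 0, 0, 0) (insert (4, 0, 0, 0) W)) :=
  Computes.append (c := [_]) (c' := [_]) (.const (by simp [regVal])) (.const (by simp [regVal]))

theorem computes_pivotEntryCode {p : ℕ} {i j : Fin (k + 1)}
    (hp : pivotStage C p (Fin.ofNat (k + 1) p) (Fin.ofNat (k + 1) p) ≠ 0)
    (h1 : (4, 0, 0, 0) ∈ W) (h0 : (5, 0, 0, 0) ∈ W) (hW : ∀ i j, (0, p, i, j) ∈ W) :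
    Computes ip (regVal ip C) W (pivotEntryCode p (Fin.ofNat (k + 1) p) i j)
      (insert (0, p + 1, i, j) W) := by
  unfold pivotEntryCode
  have hv : regVal ip C (0, p + 1, i, j) =
    pivotTransform (Fin.ofNat (k + 1) p) (pivotStage C p) i j := rfl
  rw [pivotTransform, Matrix.of_apply] at hv
  split_ifs with hi hj hj
  · rw [if_pos hi, if_pos hj] at hv
    exact .div hv hp h1 (hW _ _)
  · rw [if_pos hi, if_neg hj] at hv
    refine (Computes.append (c := [_]) (c' := [_]) (.sub rfl h0 (hW _ _))
      (.div hv hp (Or.inl rfl) (Or.inr (hW _ _)))).mono ?_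
    exact Set.insert_subset_insert (Set.subset_insert _ _)
  · rw [if_neg hi, if_pos hj] at hv
    exact .div hv hp (hW _ _) (hW _ _)
  · rw [if_neg hi, if_neg hj] at hv
    refine (Computes.append (c := [_]) (c' := [_, _]) (.mul rfl (hW _ _) (hW _ _))
      (.append (c := [_]) (c' := [_]) (.div rfl hp (Or.inl rfl) (Or.inr (hW _ _)))
      (.sub hv (Or.inr (Or.inr (hW _ _))) (Or.inl rfl)))).mono ?_
    exact Set.insert_subset_insert ((Set.subset_insert _ _).trans (Set.subset_insert _ _))

theorem computes_pivotCode (hC : C.PosDef) (h1 : (4, 0, 0, 0) ∈ W) (h0 : (5, 0, 0, 0) ∈ W)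
    (hW : ∀ i j, (0, 0, i, j) ∈ W) :
    ∀ p ≤ k + 1, Computes ip (regVal ip C) W (pivotCode k p)
      (W ∪ {r | ∃ x ∈ indexPairs k, r = (0, p, x.1, x.2)})
  | 0, _ => .nil (by
      rintro r (hr | ⟨x, -, rfl⟩)
      exacts [hr, hW _ _])
  | p + 1, hp => by
    rw [pivotCode, List.range_succ, List.flatMap_append, List.flatMap_singleton]
    refine (Computes.append (computes_pivotCode hC h1 h0 hW p (by omega))
      (.flatMap fun x _ V hV => computes_pivotEntryCode (pivotStage_pivot_pos hC hp).ne'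
        (hV (Or.inl h1)) (hV (Or.inl h0))
        fun i j => hV (Or.inr ⟨(i, j), mem_indexPairs _, rfl⟩))).mono ?_
    exact Set.union_subset_union_left _ Set.subset_union_left

theorem computes_scaleCode (hC : C.PosDef) (h1 : (4, 0, 0, 0) ∈ W)
    (hW : ∀ i j, (0, k + 1, i, j) ∈ W) :
    Computes ip (regVal ip C) W (scaleCode k)
      {r | ∃ j ∈ List.finRange (k + 1), r = (11, 0, j, 0)} := by
  have hpos : 0 < pivotStage C (k + 1) (Fin.last k) (Fin.last k) := by
    rw [pivotStage_last hC]; exact hC.inv.diag_pos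
  refine (Computes.append (c := [_, _]) (.append (c := [_]) (c' := [_])
    (.div rfl hpos.ne' h1 (hW _ _)) (.sqrt rfl (one_div_pos.mpr hpos).le (Or.inl rfl)))
    (.flatMap (d := fun j => (11, 0, j, 0)) fun j _ V hV =>
      .mul (a := (10, 0, 0, 0)) (b := (0, k + 1, j, Fin.last k)) rfl
        (hV (Or.inl rfl)) (hV (Or.inr (Or.inr (hW _ _)))))).mono Set.subset_union_right

theorem computes_coeffProgram (hip : ∀ i, 0 < ip i i)
    (hCip : ∀ i j, C i j = ip i j / (√(ip i i) * √(ip j j))) (hC : C.PosDef) :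
    Computes ip (regVal ip C) ∅ (coeffProgram k).code
      {r | ∃ j ∈ List.finRange (k + 1), r = (11, 0, j, 0)} := by
  refine computes_accessCode.append <| (computes_normCode hip ?_).append <|
    (computes_gramCode hip hCip ?_ ?_).append <| computes_constCode.append <|
    (computes_pivotCode hC ?_ ?_ ?_ _ le_rfl).append <| computes_scaleCode hC ?_ ?_
  · exact fun i j => Or.inr ⟨(i, j), mem_indexPairs _, rfl⟩
  · exact fun i j => Or.inl (Or.inr ⟨(i, j), mem_indexPairs _, rfl⟩)
  · exact fun i => Or.inr ⟨i, List.mem_finRange i, rfl⟩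
  · exact Or.inr (Or.inl rfl)
  · exact Or.inl rfl
  · exact fun i j => Or.inr (Or.inr (Or.inr ⟨(i, j), mem_indexPairs _, rfl⟩))
  · exact Or.inl (Or.inr (Or.inl rfl))
  · exact fun i j => Or.inr ⟨(i, j), mem_indexPairs _, rfl⟩

end Correctness

theorem run_coeffProgram {m n k : ℕ} {A : Matrix (Fin m) (Fin n) ℝ} {g : Fin (k + 1) → Fin m}
    (h : LinearIndependent ℝ fun i => A (g i)) :
    (coeffProgram k).run A g = some (lcuCoeff A g) := by
  have hip : ∀ i, 0 < inner ℝ (rowVec A (g i)) (rowVec A (g i)) := fun i =>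
    real_inner_self_pos.mpr (rowVec_ne_zero (h.ne_zero i))
  have hCip : ∀ i j, gramMatrix A g i j = inner ℝ (rowVec A (g i)) (rowVec A (g j)) /
      (√(inner ℝ (rowVec A (g i)) (rowVec A (g i))) *
        √(inner ℝ (rowVec A (g j)) (rowVec A (g j)))) := fun i j => by
    rw [← norm_eq_sqrt_real_inner, ← norm_eq_sqrt_real_inner, gramMatrix, Matrix.gram_apply,
      rowState, rowState, inner_smul_left, inner_smul_right, conj_trivial]
    field_simp
  have hC := gramMatrix_posDef h
  -- The precondition is empty: no initial register content is relied upon.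
  obtain ⟨s, hs, hr⟩ := computes_coeffProgram hip hCip hC (fun _ => 0) (by simp)
  rw [Program.run, hs, Option.map_some, Option.some_inj]
  ext j
  change s (reg (11, 0, j, 0)) = _
  rw [hr _ ⟨j, List.mem_finRange j, rfl⟩, lcuCoeff_eq]
  simp [regVal, pivotStage_last hC]


/-! ### Unit vectors, unitary matrices and amplitude amplification -/

section Amplification

variable {ι : Type*} [Fintype ι]

theorem star_dotProduct_self (y : ι → ℂ) : star y ⬝ᵥ y = ((‖WithLp.toLp 2 y‖ ^ 2 : ℝ) : ℂ) := by
  have h := inner_self_eq_norm_sq_to_K (𝕜 := ℂ) (WithLp.toLp 2 y)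
  rw [EuclideanSpace.inner_eq_star_dotProduct, dotProduct_comm] at h
  rw [Complex.ofReal_pow]
  exact h

variable [DecidableEq ι]

/-- A unit vector extends to an orthonormal basis, whose members serve as columns. This supplies the
state preparations. -/
theorem exists_unitary_mulVec_single (i₀ : ι) {y : ι → ℂ} (hy : star y ⬝ᵥ y = 1) :
    ∃ V : Matrix.unitaryGroup ι ℂ, ∀ i, (V : Matrix ι ι ℂ) i i₀ = y i := by
  have hyn : ‖WithLp.toLp 2 y‖ = 1 := by
    rw [star_dotProduct_self, Complex.ofReal_eq_one] at hy
    exact (pow_eq_one_iff_of_nonneg (norm_nonneg _) two_ne_zero).mp hy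
  have hv : Orthonormal ℂ (({i₀} : Set ι).domRestrict fun _ => WithLp.toLp 2 y) :=
    ⟨fun _ => hyn, fun a b hab => (hab (Subsingleton.elim a b)).elim⟩
  obtain ⟨b, hb⟩ := hv.exists_orthonormalBasis_extension_of_card_eq (by simp)
  refine ⟨⟨Matrix.of fun i j => b j i, ?_⟩, fun i => ?_⟩
  · rw [Matrix.mem_unitaryGroup_iff']
    ext i j
    have := orthonormal_iff_ite.mp b.orthonormal i j
    rw [EuclideanSpace.inner_eq_star_dotProduct, dotProduct_comm] at this
    simpa [Matrix.mul_apply, Matrix.one_apply, dotProduct] using this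
  · change b i₀ i = y i
    rw [hb i₀ rfl]

/-- The Householder reflection `I - 2 |v⟩⟨v|`. -/
def householder (v : ι → ℂ) : Matrix ι ι ℂ := 1 - (2 : ℂ) • Matrix.vecMulVec v (star v)

theorem householder_mulVec (v x : ι → ℂ) :
    householder v *ᵥ x = x - (2 * (star v ⬝ᵥ x)) • v := by
  ext i
  simp [householder, Matrix.sub_mulVec, Matrix.smul_mulVec, Matrix.vecMulVec_mulVec]
  ring

theorem householder_mem_unitaryGroup {v : ι → ℂ} (hv : star v ⬝ᵥ v = 1) :
    householder v ∈ Matrix.unitaryGroup ι ℂ := by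
  have hs : star (householder v) = householder v := by
    ext i j
    simp [householder, Matrix.star_apply, Matrix.vecMulVec_apply, Matrix.one_apply, eq_comm,
      mul_comm]
  rw [Matrix.mem_unitaryGroup_iff, hs]
  refine Matrix.ext_of_mulVec_single fun j => ?_
  rw [← Matrix.mulVec_mulVec, householder_mulVec, householder_mulVec, Matrix.one_mulVec,
    dotProduct_sub, dotProduct_smul, hv]
  ext i
  simp
  ring

theorem conj_householder {V : Matrix ι ι ℂ} (hV : V ∈ Matrix.unitaryGroup ι ℂ) (x : ι → ℂ) :
    V * householder x * Vᴴ = householder (V *ᵥ x) := by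
  have h1 : V * Vᴴ = 1 := Matrix.mem_unitaryGroup_iff.mp hV
  rw [householder, householder, Matrix.mul_sub, Matrix.sub_mul, mul_one, h1, Matrix.mul_smul,
    Matrix.smul_mul, Matrix.mul_vecMulVec, Matrix.vecMulVec_mul, Matrix.star_mulVec]

/-- Amplitude amplification: the iterates of `-(I - 2 |ψ⟩⟨ψ|)(I - 2Π)` on `ψ = sin θ • γ + ρ`,
where `γ` lies in the range and `ρ` in the kernel of the projection `Π`. -/
theorem amplification {ψ γ ρ : ι → ℂ} {S : Matrix ι ι ℂ} {θ : ℝ} (hθ : Real.cos θ ≠ 0)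
    (hψ : ψ = (Real.sin θ : ℂ) • γ + ρ) (hψ1 : star ψ ⬝ᵥ ψ = 1) (hγ : star γ ⬝ᵥ γ = 1)
    (hγρ : star γ ⬝ᵥ ρ = 0) (hSγ : S *ᵥ γ = γ) (hSρ : S *ᵥ ρ = -ρ) (N : ℕ) :
    (householder ψ * S) ^ N *ᵥ ψ = (Real.sin ((2 * N + 1) * θ) : ℂ) • γ +
      (Real.cos ((2 * N + 1) * θ) / Real.cos θ : ℂ) • ρ := by
  -- `ρ` is not normalized: its norm is `|cos θ|`, hence the division by `cos θ` in the statement.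
  have hρρ : star ρ ⬝ᵥ ρ = (Real.cos θ : ℂ) ^ 2 := by
    have hργ : star ρ ⬝ᵥ γ = 0 := by
      rw [Matrix.star_dotProduct, hγρ, star_zero]
    have h : (Real.sin θ : ℂ) ^ 2 + star ρ ⬝ᵥ ρ = 1 := by
      rw [← hψ1, hψ]
      simp only [star_add, star_smul, add_dotProduct, dotProduct_add, smul_dotProduct,
        dotProduct_smul, hγ, hγρ, hργ, smul_eq_mul, Complex.star_def, Complex.conj_ofReal]
      ring
    have h2 : (Real.sin θ : ℂ) ^ 2 + (Real.cos θ : ℂ) ^ 2 = 1 := by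
      exact_mod_cast Real.sin_sq_add_cos_sq θ
    exact add_left_cancel (h.trans h2.symm)
  have hψγ : star ψ ⬝ᵥ γ = Real.sin θ := by
    have hργ : star ρ ⬝ᵥ γ = 0 := by
      rw [Matrix.star_dotProduct, hγρ, star_zero]
    rw [hψ]
    simp only [star_add, star_smul, add_dotProduct, smul_dotProduct, hγ, hργ, smul_eq_mul,
      Complex.star_def, Complex.conj_ofReal, mul_one, add_zero]
  have hψρ : star ψ ⬝ᵥ ρ = (Real.cos θ : ℂ) ^ 2 := by
    rw [hψ]
    simp only [star_add, star_smul, add_dotProduct, smul_dotProduct, hγρ, hρρ, smul_eq_mul,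
      mul_zero, zero_add]
  have hθ' : (Real.cos θ : ℂ) ≠ 0 := Complex.ofReal_ne_zero.mpr hθ
  have hsc : (Real.sin θ : ℂ) ^ 2 = 1 - (Real.cos θ : ℂ) ^ 2 := by
    exact_mod_cast Real.sin_sq θ
  induction N with
  | zero =>
    rw [pow_zero, Matrix.one_mulVec]
    simp only [Nat.cast_zero, mul_zero, zero_add, one_mul, div_self hθ', one_smul]
    exact hψ
  | succ N ih =>
    -- Each round advances the angle by `2 * θ` in the plane of `γ` and `ρ`.
    have ha : (2 * ((N + 1 : ℕ) : ℝ) + 1) * θ = (2 * N + 1) * θ + 2 * θ := by push_cast; ring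
    rw [pow_succ', ← Matrix.mulVec_mulVec, ih, ← Matrix.mulVec_mulVec, ha]
    generalize (2 * (N : ℝ) + 1) * θ = x
    rw [Matrix.mulVec_add, Matrix.mulVec_smul, Matrix.mulVec_smul, hSγ, hSρ, householder_mulVec,
      dotProduct_add, dotProduct_smul, dotProduct_smul, dotProduct_neg, hψγ, hψρ,
      Real.sin_add, Real.cos_add, Real.sin_two_mul, Real.cos_two_mul]
    rw [hψ]
    ext i
    simp only [Pi.add_apply, Pi.sub_apply, Pi.smul_apply, Pi.neg_apply, smul_eq_mul]
    push_cast at hsc hθ' ⊢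
    field_simp
    ring_nf
    simp only [hsc]
    ring

end Amplification

/-! ### Circuit calculus -/

section Circuits

variable {m n w : ℕ}

/-- The matrix of a list of steps. -/
def gatesMatrix (U : Matrix.unitaryGroup (Fin m × Fin n) ℂ) (L : List (Gate m n w)) :
    Matrix (Sys m n w) (Sys m n w) ℂ :=
  L.foldl (fun M G => G.toMatrix U * M) 1

variable (U : Matrix.unitaryGroup (Fin m × Fin n) ℂ)

theorem foldl_toMatrix (L : List (Gate m n w)) (M : Matrix (Sys m n w) (Sys m n w) ℂ) :
    L.foldl (fun M G => G.toMatrix U * M) M = gatesMatrix U L * M := by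
  induction L generalizing M with
  | nil => simp [gatesMatrix]
  | cons G L ih =>
    rw [gatesMatrix, List.foldl_cons, List.foldl_cons, ih, ih, mul_one, mul_assoc]

@[simp]
theorem gatesMatrix_nil : gatesMatrix U ([] : List (Gate m n w)) = 1 := rfl

theorem gatesMatrix_append (L L' : List (Gate m n w)) :
    gatesMatrix U (L ++ L') = gatesMatrix U L' * gatesMatrix U L := by
  rw [gatesMatrix, List.foldl_append, foldl_toMatrix]; rfl

theorem gatesMatrix_singleton (G : Gate m n w) : gatesMatrix U [G] = G.toMatrix U := by
  simp [gatesMatrix]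

theorem gatesMatrix_cons (G : Gate m n w) (L : List (Gate m n w)) :
    gatesMatrix U (G :: L) = gatesMatrix U L * G.toMatrix U := by
  rw [← List.singleton_append, gatesMatrix_append, gatesMatrix_singleton]

theorem gatesMatrix_flatten_replicate (L : List (Gate m n w)) (N : ℕ) :
    gatesMatrix U (List.replicate N L).flatten = gatesMatrix U L ^ N := by
  induction N with
  | zero => rfl
  | succ N ih => rw [List.replicate_succ, List.flatten_cons, gatesMatrix_append, ih, pow_succ]

theorem Gate.toMatrix_mem (G : Gate m n w) :
    G.toMatrix U ∈ Matrix.unitaryGroup (Sys m n w) ℂ := by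
  cases G with
  | free V => exact V.2
  | query => exact Matrix.kronecker_mem_unitary U.2 (one_mem _)
  | queryInv => exact Matrix.kronecker_mem_unitary (star U).2 (one_mem _)

theorem gatesMatrix_mem (L : List (Gate m n w)) :
    gatesMatrix U L ∈ Matrix.unitaryGroup (Sys m n w) ℂ := by
  induction L with
  | nil => exact one_mem _
  | cons G L ih => rw [gatesMatrix_cons]; exact mul_mem ih (G.toMatrix_mem U)

/-- The inverse of a step. -/
def Gate.adj : Gate m n w → Gate m n w
  | .free V => .free (star V)
  | .query => .queryInv
  | .queryInv => .query

theorem Gate.toMatrix_adj (G : Gate m n w) : G.adj.toMatrix U = (G.toMatrix U)ᴴ := by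
  cases G <;> simp [Gate.adj, Gate.toMatrix, Matrix.conjTranspose_kronecker]
  rfl

/-- The inverse of a list of steps. -/
def adjGates (L : List (Gate m n w)) : List (Gate m n w) := (L.map Gate.adj).reverse

theorem gatesMatrix_adjGates (L : List (Gate m n w)) :
    gatesMatrix U (adjGates L) = (gatesMatrix U L)ᴴ := by
  induction L with
  | nil => simp [adjGates]
  | cons G L ih =>
    rw [adjGates] at ih
    rw [adjGates, List.map_cons, List.reverse_cons, gatesMatrix_append, ih, gatesMatrix_cons U G L,
      Matrix.conjTranspose_mul, gatesMatrix_singleton, Gate.toMatrix_adj]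

theorem countP_isQuery_adjGates (L : List (Gate m n w)) :
    (adjGates L).countP Gate.isQuery = L.countP Gate.isQuery := by
  rw [adjGates, List.countP_reverse, List.countP_map]
  congr 1
  ext G
  cases G <;> rfl

end Circuits

/-! ### The reflection on the column register and the control qubit -/

section Embedding

variable {m n : ℕ}

/-- The state `|t⟩|0⟩` of the column register and the control qubit. -/
def ctrlState (t : EuclideanSpace ℝ (Fin n)) : Fin n × Fin 2 → ℂ :=
  fun x => if x.2 = 0 then (t x.1 : ℂ) else 0

/-- The controlled reflection is itself a reflection, about `|t⟩|0⟩`; preparing `t` with the control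
at 0 thus already provides the control. -/
theorem ctrlReflection_eq (t : EuclideanSpace ℝ (Fin n)) :
    ctrlReflection t = householder (ctrlState t) := by
  ext ⟨i, a⟩ ⟨j, b⟩
  fin_cases a <;> fin_cases b <;>
    simp [ctrlReflection, reflection, householder, ctrlState, Matrix.vecMulVec_apply,
      Matrix.one_apply]

theorem star_ctrlState_dotProduct {t : EuclideanSpace ℝ (Fin n)} (ht : ‖t‖ = 1) :
    star (ctrlState t) ⬝ᵥ ctrlState t = 1 := by
  have h : ∑ i, t i * t i = 1 := by
    have := EuclideanSpace.real_norm_sq_eq t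
    rw [ht] at this
    simpa [sq] using this.symm
  simp only [dotProduct, ctrlState, Pi.star_apply, Fintype.sum_prod_type, Fin.sum_univ_two]
  simp only [if_true, Complex.star_def, Complex.conj_ofReal, one_ne_zero, if_false, mul_zero,
    add_zero]
  exact_mod_cast h

variable [NeZero m] {w : ℕ}

theorem embed_sub (φ ψ : Fin n × Fin 2 → ℂ) :
    (embed w (φ - ψ) : Sys m n w → ℂ) = embed w φ - embed w ψ := by
  ext x; simp only [embed, Pi.sub_apply]; split_ifs <;> simp

theorem embed_smul (c : ℂ) (φ : Fin n × Fin 2 → ℂ) :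
    (embed w (c • φ) : Sys m n w → ℂ) = c • embed w φ := by
  ext x; simp only [embed, Pi.smul_apply]; split_ifs <;> simp

theorem star_embed_dotProduct (φ ψ : Fin n × Fin 2 → ℂ) :
    star (embed w φ : Sys m n w → ℂ) ⬝ᵥ embed w ψ = star φ ⬝ᵥ ψ := by
  simp only [dotProduct, Pi.star_apply]
  refine (Fintype.sum_of_injective (fun x : Fin n × Fin 2 => (((0, x.1), (x.2, 0)) : Sys m n w))
    ?_ _ _ ?_ ?_).symm
  · rintro ⟨a, b⟩ ⟨c, d⟩ h
    simpa using h
  · rintro ⟨⟨i, j⟩, c, v⟩ hx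
    have : ¬ (i = 0 ∧ v = 0) := by
      rintro ⟨rfl, rfl⟩
      exact hx ⟨(j, c), rfl⟩
    simp [embed, this]
  · rintro ⟨j, c⟩
    simp [embed]

theorem norm_embed (φ : Fin n × Fin 2 → ℂ) :
    ‖WithLp.toLp 2 (embed w φ : Sys m n w → ℂ)‖ = ‖WithLp.toLp 2 φ‖ := by
  rw [← sq_eq_sq₀ (norm_nonneg _) (norm_nonneg _), ← Complex.ofReal_inj, ← star_dotProduct_self,
    ← star_dotProduct_self, star_embed_dotProduct]

/-- `embed` preserves inner products, so a reflection about an embedded vector keeps the embedded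
subspace and returns the other registers to 0. -/
theorem householder_embed_mulVec (τ φ : Fin n × Fin 2 → ℂ) :
    householder (embed w τ : Sys m n w → ℂ) *ᵥ embed w φ = embed w (householder τ *ᵥ φ) := by
  rw [householder_mulVec, householder_mulVec, star_embed_dotProduct, embed_sub, embed_smul]

end Embedding


/-! ### The circuit for the reflection -/

/-- The steps of the amplification of the amplitude prepared by `W`, from the reflection `D` about
the initial state and the sign flip `S`. -/
def amplifyGates {m n w : ℕ} (W : List (Gate m n w))
    (D S : Matrix.unitaryGroup (Sys m n w) ℂ) (N : ℕ) : List (Gate m n w) :=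
  W ++ (List.replicate N ([.free S] ++ adjGates W ++ [.free D] ++ W)).flatten

/-- The steps of the reflection about the amplified state. -/
def reflectGates {m n w : ℕ} (W : List (Gate m n w))
    (D S : Matrix.unitaryGroup (Sys m n w) ℂ) (N : ℕ) : List (Gate m n w) :=
  adjGates (amplifyGates W D S N) ++ [.free D] ++ amplifyGates W D S N

theorem countP_isQuery_reflectGates {m n w : ℕ} (W : List (Gate m n w))
    (D S : Matrix.unitaryGroup (Sys m n w) ℂ) (N : ℕ) :
    (reflectGates W D S N).countP Gate.isQuery = (4 * N + 2) * W.countP Gate.isQuery := by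
  have h : ([Gate.free S] ++ adjGates W ++ [Gate.free D] ++ W).countP Gate.isQuery =
      2 * W.countP Gate.isQuery := by
    simp only [List.countP_append, countP_isQuery_adjGates, List.countP_singleton, Gate.isQuery]
    simp; ring
  have h2 : (amplifyGates W D S N).countP Gate.isQuery = (2 * N + 1) * W.countP Gate.isQuery := by
    rw [amplifyGates, List.countP_append, List.countP_flatten, List.map_replicate, h,
      List.sum_replicate, smul_eq_mul]
    ring
  simp only [reflectGates, List.countP_append, countP_isQuery_adjGates, h2, List.countP_singleton,
    Gate.isQuery]
  simp; ring

/-- At this angle `(2 * N + 1) * θ = π / 2`, so amplification ends exactly at `γ`. Conjugating the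
reflection about `x` by the amplified unitary then reflects about `γ`. -/
theorem gatesMatrix_reflectGates {m n w : ℕ} {U : Matrix.unitaryGroup (Fin m × Fin n) ℂ}
    {W : List (Gate m n w)} {D S : Matrix.unitaryGroup (Sys m n w) ℂ} {x γ ρ : Sys m n w → ℂ}
    {N : ℕ} (hx : star x ⬝ᵥ x = 1) (hD : (D : Matrix _ _ ℂ) = householder x)
    (hγ : star γ ⬝ᵥ γ = 1) (hγρ : star γ ⬝ᵥ ρ = 0)
    (hS : (S : Matrix _ _ ℂ) *ᵥ γ = γ) (hSρ : (S : Matrix _ _ ℂ) *ᵥ ρ = -ρ) (hN : 0 < N)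
    (hW : gatesMatrix U W *ᵥ x = (Real.sin (Real.pi / (4 * N + 2)) : ℂ) • γ + ρ) :
    gatesMatrix U (reflectGates W D S N) = householder γ := by
  set θ := Real.pi / (4 * N + 2) with hθ
  have hN' : (1 : ℝ) ≤ N := by exact_mod_cast hN
  -- `0 < N` keeps `θ` strictly below `π / 2`.
  have hcos : Real.cos θ ≠ 0 := by
    refine (Real.cos_pos_of_mem_Ioo ⟨?_, ?_⟩).ne'
    · have : 0 < θ := by positivity
      linarith [Real.pi_pos]
    · exact div_lt_div_of_pos_left Real.pi_pos two_pos (by linarith)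
  have hψ : star (gatesMatrix U W *ᵥ x) ⬝ᵥ (gatesMatrix U W *ᵥ x) = 1 := by
    rw [Matrix.star_mulVec, Matrix.dotProduct_mulVec, Matrix.vecMul_vecMul,
      ← Matrix.dotProduct_mulVec]
    have : (gatesMatrix U W)ᴴ * gatesMatrix U W = 1 :=
      Matrix.mem_unitaryGroup_iff'.mp (gatesMatrix_mem U W)
    rw [this, Matrix.one_mulVec, hx]
  have hV : gatesMatrix U (amplifyGates W D S N) *ᵥ x = γ := by
    have hamp := amplification hcos hW hψ hγ hγρ hS hSρ N
    have harg : (2 * (N : ℝ) + 1) * θ = Real.pi / 2 := by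
      rw [hθ]; field_simp; ring
    rw [harg, Real.sin_pi_div_two, Real.cos_pi_div_two] at hamp
    simp only [Complex.ofReal_one, one_smul, Complex.ofReal_zero, zero_div, zero_smul,
      add_zero] at hamp
    rw [amplifyGates, gatesMatrix_append, gatesMatrix_flatten_replicate, ← Matrix.mulVec_mulVec]
    simp only [gatesMatrix_append, gatesMatrix_singleton, gatesMatrix_adjGates, Gate.toMatrix]
    rw [hD, ← mul_assoc, ← mul_assoc, conj_householder (gatesMatrix_mem U W)]
    exact hamp
  rw [reflectGates, gatesMatrix_append, gatesMatrix_append, gatesMatrix_singleton,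
    gatesMatrix_adjGates, ← mul_assoc, Gate.toMatrix, hD, conj_householder (gatesMatrix_mem U _),
    hV]

theorem sum_extend {ι κ M E : Type*} [Fintype ι] [Fintype κ] [Zero M] [AddCommMonoid E]
    {g : ι → κ} (hg : Function.Injective g) (f : ι → M) (F : κ → M → E) (hF : ∀ i, F i 0 = 0) :
    ∑ i, F i (Function.extend g f 0 i) = ∑ x, F (g x) (f x) := by
  refine (Fintype.sum_of_injective g hg _ _ (fun i hi => ?_) fun x => ?_).symm
  · rw [Function.extend_apply' _ _ _ hi, Pi.zero_apply, hF]
  · rw [hg.extend_apply]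

/-- The initial superposition: weights `f` on the rows `g`, and a rotated workspace qubit. -/
noncomputable def startState {m n l : ℕ} [NeZero n] (g : Fin l → Fin m) (f : Fin l → ℂ)
    (β : Fin 2 → ℂ) : Sys m n 1 → ℂ :=
  fun x => if x.1.2 = 0 then if x.2.1 = 0 then Function.extend g f 0 x.1.1 * β x.2.2 else 0 else 0

theorem star_startState_dotProduct {m n l : ℕ} [NeZero n] {g : Fin l → Fin m}
    (hg : Function.Injective g) {f : Fin l → ℂ} (hf : star f ⬝ᵥ f = 1) {β : Fin 2 → ℂ}
    (hβ : star β ⬝ᵥ β = 1) :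
    star (startState (n := n) g f β) ⬝ᵥ startState g f β = 1 := by
  have h1 : ∑ i, star (Function.extend g f 0 i) * Function.extend g f 0 i = 1 := by
    rw [sum_extend hg f (fun _ a => star a * a) (by simp)]; exact hf
  calc _ = ∑ i, ∑ w, (star (Function.extend g f 0 i) * Function.extend g f 0 i) *
        (star (β w) * β w) := by
        simp only [dotProduct, startState, Pi.star_apply, Fintype.sum_prod_type]
        refine Finset.sum_congr rfl fun i _ => ?_
        rw [Finset.sum_eq_single 0 (fun j _ hj => by simp [hj]) (by simp),
          Finset.sum_eq_single 0 (fun j _ hj => by simp [hj]) (by simp)]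
        refine Finset.sum_congr rfl fun w _ => ?_
        simp only [if_true, star_mul']
        ring
    _ = 1 := by
        rw [← Finset.sum_mul_sum, h1, one_mul]; exact hβ

/-- The amplitude of the linear combination after preparation, query and unpreparation. -/
theorem prepare_apply {m n l : ℕ} [NeZero m] [NeZero n] {A : Matrix (Fin m) (Fin n) ℝ}
    {g : Fin l → Fin m} (hg : Function.Injective g) (hA : ∀ j, A (g j) ≠ 0)
    {U : Matrix.unitaryGroup (Fin m × Fin n) ℂ} (hU : IsRowOracle A U) (f b : Fin l → ℂ)
    (β : Fin 2 → ℂ) {B : Matrix (Fin m) (Fin m) ℂ}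
    (hB : ∀ i, B 0 i = Function.extend g b 0 i) (j : Fin n) (c : Fin 2) :
    (((B ⊗ₖ (1 : Matrix (Fin n) (Fin n) ℂ)) ⊗ₖ (1 : Matrix (Fin 2 × Fin (1 + 1)) _ ℂ)) *ᵥ
      (((U : Matrix (Fin m × Fin n) (Fin m × Fin n) ℂ) ⊗ₖ
        (1 : Matrix (Fin 2 × Fin (1 + 1)) _ ℂ)) *ᵥ startState g f β)) ((0, j), (c, 0)) =
      if c = 0 then β 0 * ∑ x, b x * f x * (rowState A (g x) j : ℂ) else 0 := by
  have hquery : ∀ i, (((U : Matrix (Fin m × Fin n) (Fin m × Fin n) ℂ) ⊗ₖ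
      (1 : Matrix (Fin 2 × Fin (1 + 1)) _ ℂ)) *ᵥ startState g f β) ((i, j), (c, 0)) =
      if c = 0 then ∑ x, (if i = g x then (rowState A (g x) j : ℂ) else 0) * (f x * β 0)
        else 0 := by
    intro i
    simp only [Matrix.mulVec, dotProduct, Fintype.sum_prod_type, Matrix.kroneckerMap_apply,
      Matrix.one_apply, startState, Prod.mk.injEq]
    have hinner : ∀ (i' : Fin m) (j' : Fin n),
        (∑ c' : Fin 2, ∑ w' : Fin (1 + 1),
          ((U : Matrix (Fin m × Fin n) (Fin m × Fin n) ℂ) (i, j) (i', j') *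
            if c = c' ∧ 0 = w' then 1 else 0) *
            if j' = 0 then if c' = 0 then Function.extend g f 0 i' * β w' else 0 else 0) =
        if j' = 0 then if c = 0 then (U : Matrix (Fin m × Fin n) (Fin m × Fin n) ℂ) (i, j) (i', j') *
          (Function.extend g f 0 i' * β 0) else 0 else 0 := by
      intro i' j'
      rw [Finset.sum_eq_single c (fun c' _ hc => by simp [hc.symm]) (by simp),
        Finset.sum_eq_single 0 (fun w' _ hw => by simp [hw.symm]) (by simp)]
      split_ifs <;> simp_all
    simp only [hinner, Finset.sum_ite_eq', Finset.mem_univ, if_true]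
    split_ifs with hc
    · rw [sum_extend hg f
        (fun i' a => (U : Matrix (Fin m × Fin n) (Fin m × Fin n) ℂ) (i, j) (i', 0) * (a * β 0))
        (by simp)]
      -- The start state lives on column 0 and the rows `g x`, exactly where the oracle is
      -- prescribed.
      exact Finset.sum_congr rfl fun x _ => by rw [hU _ (hA x)]
    · simp
  rw [Matrix.mulVec, dotProduct, Fintype.sum_prod_type, Fintype.sum_prod_type]
  have hred : ∀ i : Fin m, (∑ j' : Fin n, ∑ y : Fin 2 × Fin (1 + 1),
      ((B ⊗ₖ (1 : Matrix (Fin n) (Fin n) ℂ)) ⊗ₖ (1 : Matrix (Fin 2 × Fin (1 + 1)) _ ℂ))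
        ((0, j), (c, 0)) ((i, j'), y) *
      (((U : Matrix (Fin m × Fin n) (Fin m × Fin n) ℂ) ⊗ₖ
        (1 : Matrix (Fin 2 × Fin (1 + 1)) _ ℂ)) *ᵥ startState g f β) ((i, j'), y)) =
      Function.extend g b 0 i *
      (((U : Matrix (Fin m × Fin n) (Fin m × Fin n) ℂ) ⊗ₖ
        (1 : Matrix (Fin 2 × Fin (1 + 1)) _ ℂ)) *ᵥ startState g f β) ((i, j), (c, 0)) := by
    intro i
    rw [Finset.sum_eq_single j, Finset.sum_eq_single (c, 0)]
    · simp [hB]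
    · intro y _ hy
      simp [Matrix.one_apply_ne hy.symm]
    · simp
    · intro j' _ hj
      simp [Matrix.one_apply_ne hj.symm]
    · simp
  simp only [hred, hquery]
  split_ifs with hc
  · rw [sum_extend hg b (fun i a => a * ∑ x, (if i = g x then (rowState A (g x) j : ℂ) else 0) *
      (f x * β 0)) (by simp), Finset.mul_sum]
    refine Finset.sum_congr rfl fun x _ => ?_
    rw [Finset.sum_eq_single x]
    · simp; ring
    · intro y _ hy
      simp [hg.ne hy.symm]
    · simp
  · simp

/-- An exact implementation of the controlled reflection about `∑ j, z j • |A_{g j}⟩`. -/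
theorem exists_circuit {m n k : ℕ} [NeZero m] [NeZero n] {g : Fin (k + 1) → Fin m}
    (hg : Function.Injective g) {z : Fin (k + 1) → ℝ}
    (hz : 1 ≤ √(k + 1) * ‖WithLp.toLp 2 z‖) :
    ∃ Q : Circuit m n, (Q.numQueries : ℝ) ≤ 10 * (√(k + 1) * ‖WithLp.toLp 2 z‖) ∧
      ∀ (A : Matrix (Fin m) (Fin n) ℝ) (U : Matrix.unitaryGroup (Fin m × Fin n) ℂ),
        (∀ j, A (g j) ≠ 0) → IsRowOracle A U → ∀ t : EuclideanSpace ℝ (Fin n),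
          t = ∑ j, z j • rowState A (g j) → ‖t‖ = 1 → ∀ ψ,
            Q.toMatrix U *ᵥ embed Q.w ψ = embed Q.w (ctrlReflection t *ᵥ ψ) := by
  set a := √(k + 1) * ‖WithLp.toLp 2 z‖ with ha
  have ha0 : 0 < a := by linarith
  have hk : (0 : ℝ) < √(k + 1) := Real.sqrt_pos.mpr (by positivity)
  have hz0 : 0 < ‖WithLp.toLp 2 z‖ := by
    by_contra h
    have : ‖WithLp.toLp 2 z‖ = 0 := le_antisymm (not_lt.mp h) (norm_nonneg _)
    rw [ha, this] at ha0
    simp at ha0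
  -- `1 / a` is the amplitude before damping; `N ≥ a` rounds make the target `sin θ` no larger than
  -- it.
  set N := ⌈a⌉₊ with hN
  have hN0 : 0 < N := Nat.ceil_pos.mpr ha0
  have hN1 : a ≤ N := Nat.le_ceil a
  have hN2 : (N : ℝ) < a + 1 := Nat.ceil_lt_add_one ha0.le
  set θ := Real.pi / (4 * N + 2) with hθ
  have hθ0 : 0 < θ := by positivity
  have hsin : 0 ≤ Real.sin θ := by
    refine Real.sin_nonneg_of_nonneg_of_le_pi hθ0.le ?_
    exact div_le_self Real.pi_pos.le (by linarith)
  -- `sin θ < θ` and `π ≤ 4` give `q ≤ 1`, so `q` is a legitimate amplitude of the workspace qubit.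
  have hq1 : Real.sin θ * a ≤ 1 := by
    have h1 : θ * a ≤ 1 := by
      rw [hθ, div_mul_eq_mul_div, div_le_one (by positivity)]
      nlinarith [Real.pi_le_four]
    nlinarith [Real.sin_lt hθ0]
  set q := Real.sin θ * a with hq
  have hq0 : 0 ≤ q := by positivity
  set β : Fin 2 → ℂ := ![(q : ℂ), (√(1 - q ^ 2) : ℂ)] with hβ
  set f : Fin (k + 1) → ℂ := fun x => ((z x / ‖WithLp.toLp 2 z‖ : ℝ) : ℂ) with hf
  set b : Fin (k + 1) → ℂ := fun _ => (((√(k + 1))⁻¹ : ℝ) : ℂ) with hb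
  have hβ1 : star β ⬝ᵥ β = 1 := by
    have h : q * q + √(1 - q ^ 2) * √(1 - q ^ 2) = 1 := by
      rw [Real.mul_self_sqrt (by nlinarith)]; ring
    simp only [dotProduct, Fin.sum_univ_two, hβ, Pi.star_apply, Matrix.cons_val_zero,
      Matrix.cons_val_one, Complex.star_def, Complex.conj_ofReal]
    exact_mod_cast h
  have hf1 : star f ⬝ᵥ f = 1 := by
    have h : ∑ x, z x / ‖WithLp.toLp 2 z‖ * (z x / ‖WithLp.toLp 2 z‖) = 1 := by
      have h2 := EuclideanSpace.real_norm_sq_eq (WithLp.toLp 2 z)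
      simp only [div_mul_div_comm]
      rw [← Finset.sum_div, div_eq_one_iff_eq (by positivity), ← sq, h2]
      exact Finset.sum_congr rfl fun x _ => (sq _).symm
    simp only [dotProduct, hf, Pi.star_apply, Complex.star_def, Complex.conj_ofReal]
    exact_mod_cast h
  have hb1 : star (Function.extend g b 0) ⬝ᵥ Function.extend g b 0 = 1 := by
    have h : ∑ _x : Fin (k + 1), (√((k : ℝ) + 1))⁻¹ * (√(k + 1))⁻¹ = 1 := by
      rw [← mul_inv, Real.mul_self_sqrt (by positivity)]
      simp
      field_simp
    simp only [dotProduct, Pi.star_apply]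
    rw [sum_extend hg b (fun _ a => star a * a) (by simp)]
    simp only [hb, Complex.star_def, Complex.conj_ofReal]
    exact_mod_cast h
  obtain ⟨P, hP⟩ := exists_unitary_mulVec_single (((0, 0), (0, 0)) : Sys m n 1)
    (star_startState_dotProduct hg hf1 hβ1)
  obtain ⟨B, hB⟩ := exists_unitary_mulVec_single (0 : Fin m) hb1
  set x₀ : Sys m n 1 → ℂ := Pi.single ((0, 0), (0, 0)) 1 with hx₀
  have hx₀1 : star x₀ ⬝ᵥ x₀ = 1 := by simp [hx₀]
  have hPx : (P : Matrix (Sys m n 1) (Sys m n 1) ℂ) *ᵥ x₀ = startState g f β := by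
    rw [hx₀, Matrix.mulVec_single_one]
    exact funext hP
  let D : Matrix.unitaryGroup (Sys m n 1) ℂ :=
    ⟨householder x₀, householder_mem_unitaryGroup hx₀1⟩
  -- The good subspace has row register and workspace both 0; `S` flips the sign of everything else.
  let σ : Sys m n 1 → ℂ := fun x => if x.1.1 = 0 ∧ x.2.2 = 0 then 1 else -1
  have hσ : Matrix.diagonal σ ∈ Matrix.unitaryGroup (Sys m n 1) ℂ := by
    rw [Matrix.mem_unitaryGroup_iff, Matrix.star_eq_conjTranspose,
      Matrix.diagonal_conjTranspose, Matrix.diagonal_mul_diagonal, ← Matrix.diagonal_one]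
    congr 1
    ext x
    simp only [σ, Pi.star_apply]
    split_ifs <;> simp
  let S : Matrix.unitaryGroup (Sys m n 1) ℂ := ⟨Matrix.diagonal σ, hσ⟩
  let B' : Matrix.unitaryGroup (Sys m n 1) ℂ :=
    ⟨(((star B : Matrix.unitaryGroup (Fin m) ℂ) : Matrix (Fin m) (Fin m) ℂ) ⊗ₖ
      (1 : Matrix (Fin n) (Fin n) ℂ)) ⊗ₖ (1 : Matrix (Fin 2 × Fin (1 + 1)) _ ℂ),
      Matrix.kronecker_mem_unitary (Matrix.kronecker_mem_unitary (star B).2 (one_mem _))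
        (one_mem _)⟩
  let W : List (Gate m n 1) := [.free P, .query, .free B']
  refine ⟨⟨1, reflectGates W D S N⟩, ?_, ?_⟩
  · have hc : W.countP Gate.isQuery = 1 := rfl
    rw [Circuit.numQueries, countP_isQuery_reflectGates, hc]
    push_cast
    -- `4 * N + 2 < 4 * a + 6 ≤ 10 * a`, since `1 ≤ a`.
    linarith
  intro A U hA hU t ht ht1 ψ
  change gatesMatrix U (reflectGates W D S N) *ᵥ embed 1 ψ = embed 1 (ctrlReflection t *ᵥ ψ)
  rw [ctrlReflection_eq, ← householder_embed_mulVec]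
  set γ : Sys m n 1 → ℂ := embed 1 (ctrlState t) with hγ
  set ρ := gatesMatrix U W *ᵥ x₀ - (Real.sin θ : ℂ) • γ with hρ
  -- On the good subspace the prepared state is exactly `sin θ • γ`, so the remainder `ρ` lies
  -- entirely in the bad one.
  have hgood : ∀ x : Sys m n 1, x.1.1 = 0 ∧ x.2.2 = 0 → ρ x = 0 := by
    rintro ⟨⟨i, j⟩, c, v⟩ ⟨hi, hv⟩
    obtain rfl : i = 0 := hi
    obtain rfl : v = 0 := hv
    have hW : gatesMatrix U W *ᵥ x₀ = (B' : Matrix (Sys m n 1) (Sys m n 1) ℂ) *ᵥ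
        (((U : Matrix (Fin m × Fin n) (Fin m × Fin n) ℂ) ⊗ₖ
          (1 : Matrix (Fin 2 × Fin (1 + 1)) _ ℂ)) *ᵥ startState g f β) := by
      rw [← hPx]
      simp only [W, gatesMatrix_cons, gatesMatrix_nil, Gate.toMatrix, one_mul,
        Matrix.mulVec_mulVec, mul_assoc]
    rw [hρ, Pi.sub_apply, hW, sub_eq_zero]
    refine (prepare_apply hg hA hU f b β (B := ((star B : Matrix.unitaryGroup (Fin m) ℂ) :
      Matrix (Fin m) (Fin m) ℂ)) (fun i => ?_) j c).trans ?_
    · have : ((star B : Matrix.unitaryGroup (Fin m) ℂ) : Matrix (Fin m) (Fin m) ℂ) 0 i =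
        star ((B : Matrix (Fin m) (Fin m) ℂ) i 0) := rfl
      rw [this, hB]
      by_cases hi : ∃ x, g x = i
      · obtain ⟨x, rfl⟩ := hi
        rw [hg.extend_apply]
        simp only [hb, Complex.star_def, Complex.conj_ofReal]
      · rw [Function.extend_apply' _ _ _ hi]; simp
    · have htj : t j = ∑ x, z x * rowState A (g x) j := by
        rw [ht]; simp
      have hsum : q * ∑ x, (√(k + 1))⁻¹ * (z x / ‖WithLp.toLp 2 z‖) * rowState A (g x) j =
          Real.sin θ * t j := by
        rw [htj, Finset.mul_sum, Finset.mul_sum]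
        refine Finset.sum_congr rfl fun x _ => ?_
        rw [hq, ha]
        field_simp
      simp only [Pi.smul_apply, smul_eq_mul, hγ, embed, ctrlState, and_self, if_true]
      split_ifs with hc
      · simp only [hβ, hb, hf, Matrix.cons_val_zero]
        exact_mod_cast hsum
      · simp
  have hbad : ∀ x : Sys m n 1, ¬ (x.1.1 = 0 ∧ x.2.2 = 0) → γ x = 0 := fun x hx => if_neg hx
  rw [gatesMatrix_reflectGates (γ := γ) (ρ := ρ) hx₀1 (D := D) rfl ?_ ?_ ?_ ?_ hN0
    (by rw [hρ, ← hθ]; abel)]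
  · rw [hγ, star_embed_dotProduct, star_ctrlState_dotProduct ht1]
  · refine Finset.sum_eq_zero fun x _ => ?_
    by_cases hx : x.1.1 = 0 ∧ x.2.2 = 0
    · rw [hgood x hx, mul_zero]
    · rw [Pi.star_apply, hbad x hx, star_zero, zero_mul]
  · ext x
    change (Matrix.diagonal σ *ᵥ γ) x = γ x
    rw [Matrix.mulVec_diagonal]
    by_cases hx : x.1.1 = 0 ∧ x.2.2 = 0
    · simp only [σ, if_pos hx, one_mul]
    · simp only [σ, hbad x hx, mul_zero]
  · ext x
    change (Matrix.diagonal σ *ᵥ ρ) x = -ρ x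
    rw [Matrix.mulVec_diagonal]
    by_cases hx : x.1.1 = 0 ∧ x.2.2 = 0
    · simp only [hgood x hx, mul_zero, neg_zero]
    · simp only [σ, if_neg hx, neg_one_mul]

/-- The empty circuit implements a controlled reflection with error `2`. -/
theorem implements_nil {m n : ℕ} [NeZero m] {U : Matrix.unitaryGroup (Fin m × Fin n) ℂ}
    {t : EuclideanSpace ℝ (Fin n)} (ht : ‖t‖ = 1) {ε : ℝ} (hε : 2 ≤ ε) :
    (⟨0, []⟩ : Circuit m n).Implements U (ctrlReflection t) ε := by
  intro ψ
  have h1 : ‖WithLp.toLp 2 (ctrlState t)‖ = 1 := by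
    have h := star_ctrlState_dotProduct ht
    rw [star_dotProduct_self, Complex.ofReal_eq_one] at h
    exact (pow_eq_one_iff_of_nonneg (norm_nonneg _) two_ne_zero).mp h
  have h2 : ‖star (ctrlState t) ⬝ᵥ ψ‖ ≤ ‖WithLp.toLp 2 ψ‖ := by
    have h := norm_inner_le_norm (𝕜 := ℂ) (WithLp.toLp 2 (ctrlState t)) (WithLp.toLp 2 ψ)
    rwa [EuclideanSpace.inner_eq_star_dotProduct, dotProduct_comm, h1, one_mul] at h
  have h3 : (⟨0, []⟩ : Circuit m n).toMatrix U = 1 := rfl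
  -- The identity differs from the reflection by twice a rank-one projection.
  rw [h3, Matrix.one_mulVec, ← embed_sub, norm_embed, ctrlReflection_eq, householder_mulVec,
    sub_sub_cancel, WithLp.toLp_smul, norm_smul, h1, mul_one, norm_mul, Complex.norm_two]
  nlinarith [norm_nonneg (WithLp.toLp 2 ψ)]

/-- For every precision and every coefficient vector there is a circuit that works for all matrices
with these coefficients. -/
theorem exists_circuit_of_coeff {m n k : ℕ} [NeZero m] [NeZero n] (g : Fin (k + 1) → Fin m)
    (ε : ℝ) (z : Fin (k + 1) → ℝ) :
    ∃ Q : Circuit m n, ∀ A : Matrix (Fin m) (Fin n) ℝ,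
      LinearIndependent ℝ (fun i => A (g i)) → lcuCoeff A g = z → 0 < ε →
        (Q.numQueries : ℝ) ≤
          20 * ((k : ℝ) + 1) * sigmaMin (gramMatrix A g) ^ (-(1 / 2) : ℝ) * ε⁻¹ ∧
        ∀ U : Matrix.unitaryGroup (Fin m × Fin n) ℂ, IsRowOracle A U →
          Q.Implements U (ctrlReflection (orthoState A g)) ε := by
  by_cases hε : 2 ≤ ε
  · refine ⟨⟨0, []⟩, fun A hA _ hε0 => ⟨?_, fun U _ => implements_nil (norm_orthoState hA) hε⟩⟩
    have := Real.rpow_nonneg (sigmaMin_pos (gramMatrix_posDef hA)).le (-(1 / 2))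
    simp only [Circuit.numQueries, List.countP_nil, Nat.cast_zero]
    positivity
  -- Both conditions hold for the coefficients of any independent rows; otherwise an arbitrary
  -- circuit will do.
  by_cases hz : Function.Injective g ∧ 1 ≤ √(k + 1) * ‖WithLp.toLp 2 z‖
  · obtain ⟨Q, hQ, hQi⟩ := exists_circuit (n := n) hz.1 hz.2
    refine ⟨Q, fun A hA hAz hε0 => ⟨hQ.trans ?_, fun U hU ψ => ?_⟩⟩
    · have h1 := norm_lcuCoeff_le hA
      rw [hAz] at h1
      have h2 : √((k : ℝ) + 1) ≤ k + 1 :=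
        Real.sqrt_le_iff.mpr ⟨by positivity, by nlinarith [k.cast_nonneg (α := ℝ)]⟩
      -- As `ε < 2`, the bound `10 * a` is at most `20 * a * ε⁻¹`.
      have h3 : (1 / 2 : ℝ) ≤ ε⁻¹ := by
        rw [one_div]; exact inv_anti₀ hε0 (not_le.mp hε).le
      have h4 := mul_le_mul h2 h1 (norm_nonneg _) (by positivity)
      have h5 : 0 ≤ ((k : ℝ) + 1) * sigmaMin (gramMatrix A g) ^ (-(1 / 2) : ℝ) :=
        (by positivity : (0 : ℝ) ≤ √(k + 1) * ‖WithLp.toLp 2 z‖).trans h4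
      nlinarith
    · rw [hQi A U (fun j => hA.ne_zero j) hU _ (hAz ▸ orthoState_eq_sum hA) (norm_orthoState hA),
        sub_self, WithLp.toLp_zero, norm_zero]
      positivity
  · refine ⟨⟨0, []⟩, fun A hA hAz _ => (hz ⟨?_, ?_⟩).elim⟩
    · exact fun i j hij => hA.injective (congrArg A hij)
    · rw [← hAz]; exact one_le_sqrt_mul_norm_lcuCoeff hA

end QGSP

theorem theorem4 :
    ∃ K : ℝ, 0 < K ∧
      ∀ k : ℕ, ∃ P : QGSP.Program (k + 1),
        (P.numOps : ℝ) ≤ K * ((k : ℝ) + 1) ^ 3 ∧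
        (P.numInner : ℝ) ≤ K * ((k : ℝ) + 1) ^ 2 ∧
        ∀ (m n : ℕ) [NeZero m] [NeZero n] (g : Fin (k + 1) → Fin m),
          ∃ circ : ℝ → (Fin (k + 1) → ℝ) → QGSP.Circuit m n,
            ∀ A : Matrix (Fin m) (Fin n) ℝ,
              LinearIndependent ℝ (fun i => A (g i)) →
                P.run A g = some (QGSP.lcuCoeff A g) ∧
                QGSP.orthoState A g =
                  ∑ j, QGSP.lcuCoeff A g j • QGSP.rowState A (g j) ∧
                ∀ ε : ℝ, 0 < ε →
                  ((circ ε (QGSP.lcuCoeff A g)).numQueries : ℝ) ≤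
                    K * ((k : ℝ) + 1) *
                      QGSP.sigmaMin (QGSP.gramMatrix A g) ^ (-(1 / 2) : ℝ) * ε⁻¹ ∧
                  ∀ U : Matrix.unitaryGroup (Fin m × Fin n) ℂ,
                    QGSP.IsRowOracle A U →
                      (circ ε (QGSP.lcuCoeff A g)).Implements U
                        (QGSP.ctrlReflection (QGSP.orthoState A g)) ε := by
  refine ⟨20, by norm_num, fun k => ⟨QGSP.coeffProgram k, ?_, ?_, fun m n _ _ g => ?_⟩⟩
  · have h : ((QGSP.coeffProgram k).numOps : ℝ) ≤ 12 * ((k : ℝ) + 1) ^ 3 := by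
      exact_mod_cast QGSP.numOps_coeffProgram_le k
    exact h.trans (by gcongr; norm_num)
  · have h : ((QGSP.coeffProgram k).numInner : ℝ) ≤ ((k : ℝ) + 1) ^ 2 := by
      exact_mod_cast QGSP.numInner_coeffProgram_le k
    exact h.trans (le_mul_of_one_le_left (by positivity) (by norm_num))
  · choose circ hcirc using QGSP.exists_circuit_of_coeff (n := n) g
    exact ⟨circ, fun A hA => ⟨QGSP.run_coeffProgram hA, QGSP.orthoState_eq_sum hA,
      fun ε hε => hcirc ε _ A hA rfl hε⟩⟩
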